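/- Fix $n,L,N\ge 1$ and put $d=2^n$. Let $\sigma_A$, $A\in\{0,1,2,3\}^n$, be the $n$-qubit Pauli strings. For a complex $4^n\times 4^n$ matrix $W$ put $$\phi^{W}(\rho)=\sum_{A,B}\Big(\frac{\delta_{A,B}}{4^n}+W(A,B)\Big)\,\sigma_A\,\rho\,\sigma_B ,$$ so that $\phi^0$ is the maximally depolarizing channel. Let $\mathcal X$ be a measurable space and $x\mapsto\rho(x)$ a (measurable) map from $\mathcal X$ to density matrices on $\mathbb C^{d}$. A parameter vector $w=(W_1,\dots,W_L)$ is admissible if every $\phi^{W_j}$ is a quantum channel (completely positive and trace preserving); its model is $$f_w(x)[k]=\langle k|\,(\phi^{W_L}\circ\cdots\circ\phi^{W_1})(\rho(x))\,|k\rangle ,$$ where $k$ ranges over the $K=2^n$ computational basis labels, which are also the class labels. For a probability distribution $\mathcal D$ of labelled examples $(x,y)$ and $\gamma\ge 0$ let $$L_\gamma(f)=\mathbb P_{(x,y)\sim\mathcal D}\Big[f(x)[y]\le\gamma+\max_{k\ne y}f(x)[k]\Big],$$ and let $\hat L_\gamma(f)$ be the fraction of the $N$ training examples for which this event occurs. For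 admissible $w$ let $\xi_j=\|W_j\|_0$ be the number of non-zero entries of $W_j$, $\xi_{\max}=\max_j\xi_j$, $\|W\|_{1,1}=\sum_{A,B}|W(A,B)|$, $\|W\|_F^2=\sum_{A,B}|W(A,B)|^2$, $\|w\|^2=\sum_{j=1}^L\|W_j\|_F^2$, $$\beta_{\rm PM}=\sum_{j=1}^L\prod_{\ell=j+1}^L\|W_\ell\|_{1,1},\qquad M(n,L,\xi)=\frac{c^L-1}{c-1},\quad c=\frac{2\xi^2+\xi-2}{4^n}$$ (with $M=L$ if $c=1$). Theorem. There is an absolute constant $C>0$ such that for all $n,L,N\ge1$, all $\mathcal X,\rho,\mathcal D$ as above and all $\gamma,\delta>0$, with probability at least $1-\delta$ over $N$ independent training examples drawn from $\mathcal D$, the following holds simultaneously for all admissible $w$: $$L_0(f_w)\le \hat L_\gamma(f_w)+C\sqrt{\frac{\beta_{\rm PM}^2\,\xi_{\max}\,\ln\!\Big(\sum_{j=1}^L2^{\xi_j}\Big)\sum_{j=1}^L\|W_j\|_F^2+\ln\!\Big(\frac{N\,L\,\min\{\max\{1,\gamma\sqrt N/\|w\|\},\,M(n,L,\xi_{\max})\}}{\delta}\Big)}{\gamma^2N}}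 ,$$ where $\gamma\sqrt N/\|w\|$ is read as $+\infty$ if $w=0$. -/

import Mathlib

open MeasureTheory
open scoped ComplexOrder

noncomputable section

namespace PMModel

/-- Computational basis labels of `n` qubits; these are also the `K = 2 ^ n` class labels. -/
abbrev Basis (n : ℕ) : Type := Fin n → Fin 2

/-- Labels of the `4 ^ n` Pauli strings on `n` qubits. -/
abbrev PauliIdx (n : ℕ) : Type := Fin n → Fin 4

/-- Operators on the Hilbert space of `n` qubits. -/
abbrev Op (n : ℕ) : Type := Matrix (Basis n) (Basis n) ℂ

/-- Weight matrices (and process matrices): complex matrices indexed by pairs of Pauli strings. -/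
abbrev Weight (n : ℕ) : Type := Matrix (PauliIdx n) (PauliIdx n) ℂ

/-- The single-qubit Pauli matrices `I, X, Y, Z`. -/
def pauliOne : Fin 4 → Matrix (Fin 2) (Fin 2) ℂ :=
  ![!![1, 0; 0, 1], !![0, 1; 1, 0], !![0, -Complex.I; Complex.I, 0], !![1, 0; 0, -1]]

/-- The Pauli string `σ_A = σ_{A 0} ⊗ ⋯ ⊗ σ_{A (n-1)}`. -/
def pauli {n : ℕ} (A : PauliIdx n) : Op n :=
  Matrix.of fun a b => ∏ i, pauliOne (A i) (a i) (b i)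

/-- The process matrix `χ(A,B) = δ_{A,B} / 4 ^ n + W(A,B)`. -/
def processMatrix {n : ℕ} (W : Weight n) : Weight n :=
  Matrix.of fun A B => (if A = B then (1 : ℂ) / 4 ^ n else 0) + W A B

/-- The layer map `φ_PM^W(X) = ∑_{A,B} χ(A,B) σ_A X σ_B`. -/
def layer {n : ℕ} (W : Weight n) : Op n →ₗ[ℂ] Op n where
  toFun X := ∑ A, ∑ B, processMatrix W A B • (pauli A * X * pauli B)
  map_add' X Y := by
    simp only [mul_add, add_mul, smul_add, Finset.sum_add_distrib]
  map_smul' c X := by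
    simp only [Matrix.mul_smul, Matrix.smul_mul, Finset.smul_sum, RingHom.id_apply]
    exact Finset.sum_congr rfl fun A _ => Finset.sum_congr rfl fun B _ => smul_comm _ _ _

/-- The amplification `id_m ⊗ φ`, acting blockwise. -/
def amplify {n : ℕ} (m : ℕ) (φ : Op n →ₗ[ℂ] Op n)
    (X : Matrix (Fin m × Basis n) (Fin m × Basis n) ℂ) :
    Matrix (Fin m × Basis n) (Fin m × Basis n) ℂ :=
  Matrix.of fun p q => φ (Matrix.of fun a b => X (p.1, a) (q.1, b)) p.2 q.2

/-- A quantum channel: a completely positive and trace-preserving linear map. -/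
structure IsQuantumChannel {n : ℕ} (φ : Op n →ₗ[ℂ] Op n) : Prop where
  completelyPositive : ∀ (m : ℕ) (X : Matrix (Fin m × Basis n) (Fin m × Basis n) ℂ),
    X.PosSemidef → (amplify m φ X).PosSemidef
  tracePreserving : ∀ X : Op n, (φ X).trace = X.trace

/-- A density matrix: positive semidefinite of trace one. -/
structure IsDensity {n : ℕ} (ρ : Op n) : Prop where
  posSemidef : ρ.PosSemidef
  trace_eq_one : ρ.trace = 1

/-- The output state `(φ_L ∘ ⋯ ∘ φ_1)(ρ)`; the layer with index `0` acts first. -/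
def outputState {n L : ℕ} (W : Fin L → Weight n) (ρ : Op n) : Op n :=
  Fin.foldl L (fun τ j => layer (W j) τ) ρ

/-- The model output `f_w(x)[k] = Tr(|k⟩⟨k| ρ_out)` as a function of the encoded state. -/
def modelOutput {n L : ℕ} (W : Fin L → Weight n) (ρ : Op n) (k : Basis n) : ℝ :=
  ((Matrix.single k k (1 : ℂ) * outputState W ρ).trace).re

/-- The margin error event `f[y] ≤ γ + max_{k ≠ y} f[k]` for a score vector `f` and label `y`. -/
def MarginError {n : ℕ} (γ : ℝ) (f : Basis n → ℝ) (y : Basis n) : Prop :=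
  ∃ k, k ≠ y ∧ f y ≤ γ + f k

/-- The expected margin loss `L_γ` of `g : X → ℝ^K` under the distribution `D`. -/
def expectedLoss {n : ℕ} {X : Type*} [MeasurableSpace X] (D : Measure (X × Basis n)) (γ : ℝ)
    (g : X → Basis n → ℝ) : ℝ :=
  D.real {z | MarginError γ (g z.1) z.2}

open Classical in
/-- The empirical margin loss on the sample `S`: the fraction of margin errors. -/
def empiricalLoss {n N : ℕ} {X : Type*} (S : Fin N → X × Basis n) (γ : ℝ)
    (g : X → Basis n → ℝ) : ℝ :=
  ((Finset.univ.filter fun i => MarginError γ (g (S i).1) (S i).2).card : ℝ) / N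

open Classical in
/-- The sparsity `‖W‖_0`: the number of non-zero entries. -/
def sparsity {n : ℕ} (W : Weight n) : ℕ :=
  (Finset.univ.filter fun p : PauliIdx n × PauliIdx n => W p.1 p.2 ≠ 0).card

/-- The entrywise 1-norm `‖W‖_{1,1}`. -/
def normOneOne {n : ℕ} (W : Weight n) : ℝ := ∑ A, ∑ B, ‖W A B‖

/-- The squared Frobenius norm `‖W‖_F ^ 2`. -/
def frobSq {n : ℕ} (W : Weight n) : ℝ := ∑ A, ∑ B, ‖W A B‖ ^ 2

/-- `∑_j ‖W_j‖_F ^ 2`, the squared Euclidean norm of the full parameter vector. -/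
def totalFrobSq {n L : ℕ} (W : Fin L → Weight n) : ℝ := ∑ j, frobSq (W j)

/-- `ξ_max = max_j ‖W_j‖_0`. -/
def maxSparsity {n L : ℕ} (W : Fin L → Weight n) : ℕ :=
  Finset.univ.sup fun j => sparsity (W j)

/-- `β_PM = ∑_j ∏_{ℓ > j} ‖W_ℓ‖_{1,1}`. -/
def betaPM {n L : ℕ} (W : Fin L → Weight n) : ℝ :=
  ∑ j, ∏ l ∈ Finset.univ.filter (fun l => j < l), normOneOne (W l)

/-- The ratio `(2 ξ ^ 2 + ξ - 2) / 4 ^ n`. -/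
def growthRatio (n ξ : ℕ) : ℝ := (2 * (ξ : ℝ) ^ 2 + ξ - 2) / 4 ^ n

open Classical in
/-- `M(n, L, ξ) = (c ^ L - 1) / (c - 1)` with `c = (2 ξ ^ 2 + ξ - 2) / 4 ^ n`, and its limiting
value `L` if `c = 1`. -/
def growthM (n L ξ : ℕ) : ℝ :=
  if growthRatio n ξ = 1 then (L : ℝ)
  else (growthRatio n ξ ^ L - 1) / (growthRatio n ξ - 1)

open Classical in
/-- `min {max {1, γ √N / ‖w‖}, M(n, L, ξ_max)}`, the first entry being `+∞` if `w = 0`. -/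
def betaCap {n L : ℕ} (N : ℕ) (γ : ℝ) (W : Fin L → Weight n) : ℝ :=
  if totalFrobSq W = 0 then growthM n L (maxSparsity W)
  else min (max 1 (γ * √(N : ℝ) / √(totalFrobSq W))) (growthM n L (maxSparsity W))

/-- The complexity term under the big-O:
`√((β² ξ_max ln(∑_j 2 ^ ξ_j) ∑_j ‖W_j‖_F² + ln(N L betaCap / δ)) / (γ² N))`. -/
def complexity {n L : ℕ} (N : ℕ) (γ δ : ℝ) (W : Fin L → Weight n) : ℝ :=
  √((betaPM W ^ 2 * (maxSparsity W : ℝ) * Real.log (∑ j, (2 : ℝ) ^ sparsity (W j)) * totalFrobSq W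
      + Real.log ((N : ℝ) * L * betaCap N γ W / δ)) / (γ ^ 2 * N))

end PMModel

end

open scoped BigOperators

/-! ### Averages over random signs -/

namespace SignAverage

/-! Each layer sends a state to the maximally mixed state plus a `W`-weighted sum of words σ_A τ
σ_B. Products of Pauli strings are Pauli strings up to a phase, so unrolling the layers writes
"output minus maximally mixed" as a combination of words in the input or the maximally mixed state,
with coefficients of total modulus at most `chainNorm W` = ∑_j ∏_{ℓ≥j} ‖W_ℓ‖_{1,1}. A linear
functional of the outputs is therefore at most `chainNorm W` times its maximum over a fixed family
of order 16^n words (`norm_functional_sub_le`).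

This controls the Rademacher average of the ramp loss, which lies between the two margin losses.
Vector contraction removes the loss at cost of order 1/γ, the word bound replaces the supremum over
models by a finite maximum, and Massart's lemma evaluates it. Each word has diagonal of Euclidean
norm at most 1, so the number 2^n of classes does not enter; with `chainNorm W ≤ g` the result is of
order (g/γ)√(nN) (`expect_iSup_rampLoss_le`). A symmetrised exponential moment gives uniform
deviations (`measure_exists_gt_le`), and a union bound over dyadic scales g = γ2^r makes them
uniform in all models.

Two comparisons reach the stated complexity. Cauchy–Schwarz gives `chainNorm W ^ 2 ≤ betaPM W ^ 2 *
maxSparsity W * totalFrobSq W`. The factor n is traded for `maxSparsity W` up to an additive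
constant (`mul_chainNorm_sq_le`): positivity of the process matrix forces the entries of a sparse
admissible weight to be of order ξ/4^n, so when ξ < n the model is almost constant. The remaining
cases are trivial: if γ is at least 1 or at least twice `chainNorm W`, every example is a margin
error; if N = 1 and γ is smaller, the right-hand side exceeds 1. -/

theorem expect_units (f : ℤˣ → ℝ) : 𝔼 s, f s = (f 1 + f (-1)) / 2 := by
  rw [Fintype.expect_eq_sum_div_card, UnitsInt.univ]
  simp

theorem expect_fin_succ {α : Type*} [Fintype α] {N : ℕ} (F : (Fin (N + 1) → α) → ℝ) :
    𝔼 ε, F ε = 𝔼 a, 𝔼 ε : Fin N → α, F (Fin.cons a ε) := by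
  rw [← Finset.expect_product', Finset.univ_product_univ]
  exact (Fintype.expect_equiv (Fin.consEquiv fun _ => α) _ _ fun _ => rfl).symm

theorem expect_le_expect_univ {α : Type*} [Fintype α] {f g : α → ℝ} (h : ∀ a, f a ≤ g a) :
    𝔼 a, f a ≤ 𝔼 a, g a :=
  Finset.expect_le_expect fun a _ => h a

theorem expect_signs_neg {J : Type*} [Fintype J] [DecidableEq J] (F : (J → ℤˣ) → ℝ) :
    𝔼 κ, F (-κ) = 𝔼 κ, F κ :=
  Fintype.expect_equiv (Equiv.neg _) _ _ fun _ => rfl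

theorem expect_signs_exp {J : Type*} [Fintype J] [DecidableEq J] (g : J → ℝ) :
    𝔼 κ : J → ℤˣ, Real.exp (∑ j, ((κ j : ℤ) : ℝ) * g j) = ∏ j, Real.cosh (g j) := by
  have h := Finset.prod_univ_sum (fun _ : J => (Finset.univ : Finset ℤˣ))
    (fun j s => Real.exp (((s : ℤ) : ℝ) * g j))
  rw [Fintype.piFinset_univ] at h
  rw [Fintype.expect_eq_sum_div_card]
  simp_rw [Real.exp_sum]
  rw [← h]
  simp only [UnitsInt.univ, Fintype.card_pi, Fintype.card_units_int, Finset.prod_const]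
  rw [Finset.card_univ, Nat.cast_pow, ← Finset.card_univ, ← Finset.prod_const,
    ← Finset.prod_div_distrib]
  refine Finset.prod_congr rfl fun j _ => ?_
  rw [Real.cosh_eq]
  simp

theorem expect_signs_exp_le {J : Type*} [Fintype J] [DecidableEq J] (g : J → ℝ) :
    𝔼 κ : J → ℤˣ, Real.exp (∑ j, ((κ j : ℤ) : ℝ) * g j) ≤ Real.exp ((∑ j, g j ^ 2) / 2) := by
  rw [expect_signs_exp, Finset.sum_div, Real.exp_sum]
  exact Finset.prod_le_prod (fun j _ => (Real.cosh_pos _).le)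
    fun j _ => Real.cosh_le_exp_half_sq _

/-- Jensen's inequality, by averaging the tangent line of the exponential at the mean. -/
theorem exp_expect_le {α : Type*} [Fintype α] [Nonempty α] (f : α → ℝ) :
    Real.exp (𝔼 a, f a) ≤ 𝔼 a, Real.exp (f a) := by
  set m := 𝔼 a, f a with hm
  have h : ∀ a, Real.exp m * (f a - m + 1) ≤ Real.exp (f a) := fun a => by
    have := Real.add_one_le_exp (f a - m)
    calc Real.exp m * (f a - m + 1) ≤ Real.exp m * Real.exp (f a - m) :=
          mul_le_mul_of_nonneg_left this (Real.exp_pos _).le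
      _ = Real.exp (f a) := by rw [← Real.exp_add]; ring_nf
  have h2 := expect_le_expect_univ h
  rw [← Finset.mul_expect, Finset.expect_add_distrib, Finset.expect_sub_distrib,
    Fintype.expect_const, Fintype.expect_const, ← hm] at h2
  simpa using h2

/-- The bounded differences inequality on the cube of signs, in exponential form. -/
theorem expect_exp_le_of_bounded_differences {N : ℕ} (c : ℝ) (F : (Fin N → ℤˣ) → ℝ)
    (hF : ∀ i ε ε', (∀ j, j ≠ i → ε j = ε' j) → |F ε - F ε'| ≤ 2 * c) :
    𝔼 ε, Real.exp (F ε) ≤ Real.exp (𝔼 ε, F ε + N * c ^ 2 / 2) := by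
  induction N with
  | zero =>
    simp
  | succ N ih =>
    rw [expect_fin_succ, expect_fin_succ F, expect_units, expect_units]
    have key : ∀ s, 𝔼 ε : Fin N → ℤˣ, Real.exp (F (Fin.cons s ε)) ≤
        Real.exp (𝔼 ε : Fin N → ℤˣ, F (Fin.cons s ε) + N * c ^ 2 / 2) := fun s =>
      ih (fun ε => F (Fin.cons s ε)) fun i ε ε' h => hF i.succ _ _ fun j hj => by
        cases j using Fin.cases with
        | zero => rfl
        | succ j => simpa using h j fun h => hj (by rw [h])
    have hd : |𝔼 ε : Fin N → ℤˣ, F (Fin.cons 1 ε) - 𝔼 ε : Fin N → ℤˣ, F (Fin.cons (-1) ε)|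
        ≤ 2 * c := by
      rw [← Finset.expect_sub_distrib]
      have hp : ∀ ε : Fin N → ℤˣ, |F (Fin.cons 1 ε) - F (Fin.cons (-1) ε)| ≤ 2 * c := fun ε =>
        hF 0 _ _ fun j hj => by
          cases j using Fin.cases with
          | zero => exact absurd rfl hj
          | succ j => rfl
      rw [abs_le]
      constructor
      · rw [← Fintype.expect_const (ι := Fin N → ℤˣ) (-(2 * c))]
        exact expect_le_expect_univ fun ε => (abs_le.1 (hp ε)).1
      · rw [← Fintype.expect_const (ι := Fin N → ℤˣ) (2 * c)]
        exact expect_le_expect_univ fun ε => (abs_le.1 (hp ε)).2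
    have k1 := key 1
    have k2 := key (-1)
    set p := 𝔼 ε : Fin N → ℤˣ, F (Fin.cons 1 ε)
    set q := 𝔼 ε : Fin N → ℤˣ, F (Fin.cons (-1) ε)
    -- The two conditional means differ by at most 2c, so the new sign contributes a factor cosh of
    -- at most c, hence exp(c²/2).
    have hc : Real.cosh ((p - q) / 2) ≤ Real.exp (c ^ 2 / 2) := by
      refine (Real.cosh_le_exp_half_sq _).trans (Real.exp_le_exp.2 ?_)
      have : (p - q) ^ 2 ≤ (2 * c) ^ 2 := sq_le_sq' (by linarith [(abs_le.1 hd).1])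
        (abs_le.1 hd).2
      nlinarith
    calc _ ≤ (Real.exp (p + N * c ^ 2 / 2) + Real.exp (q + N * c ^ 2 / 2)) / 2 := by linarith
      _ = Real.exp ((p + q) / 2 + N * c ^ 2 / 2) * Real.cosh ((p - q) / 2) := by
        rw [Real.cosh_eq, mul_div_assoc', mul_add, ← Real.exp_add, ← Real.exp_add]
        ring_nf
      _ ≤ Real.exp ((p + q) / 2 + N * c ^ 2 / 2) * Real.exp (c ^ 2 / 2) :=
        mul_le_mul_of_nonneg_left hc (Real.exp_pos _).le
      _ = _ := by
        rw [← Real.exp_add]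
        push_cast
        ring_nf

theorem moments_fin {m : ℕ} (v : Fin m → ℝ) :
    𝔼 κ : Fin m → ℤˣ, (∑ k, ((κ k : ℤ) : ℝ) * v k) ^ 2 = ∑ k, v k ^ 2 ∧
    𝔼 κ : Fin m → ℤˣ, (∑ k, ((κ k : ℤ) : ℝ) * v k) ^ 4 ≤ 3 * (∑ k, v k ^ 2) ^ 2 := by
  induction m with
  | zero => simp
  | succ m ih =>
    obtain ⟨h2, h4⟩ := ih fun k => v k.succ
    rw [expect_fin_succ, expect_fin_succ, expect_units, expect_units]
    simp only [Fin.sum_univ_succ, Fin.cons_zero, Fin.cons_succ, ← Finset.expect_add_distrib]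
    constructor
    · rw [← h2, Finset.expect_div]
      have : ∀ κ : Fin m → ℤˣ,
          (((((1 : ℤˣ) : ℤ) : ℝ) * v 0 + ∑ k, ((κ k : ℤ) : ℝ) * v k.succ) ^ 2
          + ((((-1 : ℤˣ) : ℤ) : ℝ) * v 0 + ∑ k, ((κ k : ℤ) : ℝ) * v k.succ) ^ 2) / 2
          = v 0 ^ 2 + (∑ k, ((κ k : ℤ) : ℝ) * v k.succ) ^ 2 := fun κ => by
        push_cast
        ring
      rw [Finset.expect_congr rfl fun κ _ => this κ, Finset.expect_add_distrib,
        Fintype.expect_const]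
    · set s := ∑ k : Fin m, v k.succ ^ 2
      have hs : 0 ≤ s := Finset.sum_nonneg fun _ _ => sq_nonneg _
      have : (𝔼 κ : Fin m → ℤˣ,
          (((((1 : ℤˣ) : ℤ) : ℝ) * v 0 + ∑ k, ((κ k : ℤ) : ℝ) * v k.succ) ^ 4
          + ((((-1 : ℤˣ) : ℤ) : ℝ) * v 0 + ∑ k, ((κ k : ℤ) : ℝ) * v k.succ) ^ 4)) / 2
          = v 0 ^ 4 + 6 * v 0 ^ 2 * 𝔼 κ : Fin m → ℤˣ, (∑ k, ((κ k : ℤ) : ℝ) * v k.succ) ^ 2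
          + 𝔼 κ : Fin m → ℤˣ, (∑ k, ((κ k : ℤ) : ℝ) * v k.succ) ^ 4 := by
        rw [Finset.expect_div, Finset.mul_expect]
        have : ∀ κ : Fin m → ℤˣ,
            (((((1 : ℤˣ) : ℤ) : ℝ) * v 0 + ∑ k, ((κ k : ℤ) : ℝ) * v k.succ) ^ 4
            + ((((-1 : ℤˣ) : ℤ) : ℝ) * v 0 + ∑ k, ((κ k : ℤ) : ℝ) * v k.succ) ^ 4) / 2
            = v 0 ^ 4 + 6 * v 0 ^ 2 * (∑ k, ((κ k : ℤ) : ℝ) * v k.succ) ^ 2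
            + (∑ k, ((κ k : ℤ) : ℝ) * v k.succ) ^ 4 := fun κ => by
          push_cast
          ring
        rw [Finset.expect_congr rfl fun κ _ => this κ, Finset.expect_add_distrib,
          Finset.expect_add_distrib, Fintype.expect_const]
      rw [this, h2]
      nlinarith [sq_nonneg (v 0 ^ 2)]

/-- Khintchine's inequality for the first moment, with constant `9 / 5 ≤ 2`. -/
theorem sqrt_sum_sq_le {K : Type*} [Fintype K] [DecidableEq K] (v : K → ℝ) :
    √(∑ k, v k ^ 2) ≤ 2 * 𝔼 κ : K → ℤˣ, |∑ k, ((κ k : ℤ) : ℝ) * v k| := by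
  have transfer : ∀ f : ℝ → ℝ, 𝔼 κ : K → ℤˣ, f (∑ k, ((κ k : ℤ) : ℝ) * v k) =
      𝔼 κ : Fin (Fintype.card K) → ℤˣ,
        f (∑ k, ((κ k : ℤ) : ℝ) * v ((Fintype.equivFin K).symm k)) := fun f =>
    Fintype.expect_equiv ((Fintype.equivFin K).arrowCongr (Equiv.refl _)) _ _ fun κ => by
      congr 1
      exact Fintype.sum_equiv (Fintype.equivFin K) _ _ fun k => by simp
  obtain ⟨h2, h4⟩ := moments_fin fun k => v ((Fintype.equivFin K).symm k)
  rw [← transfer fun x => x ^ 2] at h2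
  rw [← transfer fun x => x ^ 4] at h4
  rw [← Equiv.sum_comp (Fintype.equivFin K).symm fun k => v k ^ 2]
  set s := ∑ k, v ((Fintype.equivFin K).symm k) ^ 2
  have hs : 0 ≤ s := Finset.sum_nonneg fun _ _ => sq_nonneg _
  rcases hs.eq_or_lt with h0 | h0
  · rw [← h0, Real.sqrt_zero]
    exact mul_nonneg (by norm_num) (Finset.expect_nonneg fun _ _ => abs_nonneg _)
  set r := √s with hr
  have hr0 : 0 < r := Real.sqrt_pos.2 h0
  have hrs : r ^ 2 = s := Real.sq_sqrt hs
  -- The left side touches |x| at |x| = 3r/2, as the squared factor shows. With second moment r² and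
  -- fourth moment at most 3r⁴ its average is at least 5r/9.
  have hpt : ∀ x : ℝ, x ^ 2 / r - 4 / 27 * (x ^ 4 / r ^ 3) ≤ |x| := fun x => by
    have e : |x| - (x ^ 2 / r - 4 / 27 * (x ^ 4 / r ^ 3)) =
        |x| * (4 / 27 * (|x| / r - 3 / 2) ^ 2 * (|x| / r + 3)) := by
      rw [← sq_abs x, show x ^ 4 = |x| ^ 4 by rw [← abs_pow, abs_of_nonneg (by positivity)]]
      field_simp
      ring
    have : 0 ≤ |x| * (4 / 27 * (|x| / r - 3 / 2) ^ 2 * (|x| / r + 3)) := by positivity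
    linarith
  have h := expect_le_expect_univ fun κ : K → ℤˣ => hpt (∑ k, ((κ k : ℤ) : ℝ) * v k)
  rw [Finset.expect_sub_distrib, ← Finset.mul_expect, ← Finset.expect_div, ← Finset.expect_div,
    h2] at h
  have e1 : s / r = r := by rw [← hrs]; field_simp
  have e2 : (𝔼 κ : K → ℤˣ, (∑ k, ((κ k : ℤ) : ℝ) * v k) ^ 4) / r ^ 3 ≤ 3 * r := by
    rw [div_le_iff₀ (by positivity)]
    calc _ ≤ 3 * s ^ 2 := h4
      _ = _ := by rw [← hrs]; ring
  rw [e1] at h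
  linarith

theorem le_iSup_finite {ι : Type*} [Finite ι] (f : ι → ℝ) (a : ι) : f a ≤ ⨆ b, f b :=
  le_ciSup (Set.finite_range f).bddAbove a

/-- One coordinate of the contraction principle. Take maximisers a, b for the two signs; the
Lipschitz bound and Khintchine turn h a - h b into an average of |⟨κ, v a - v b⟩|. Whichever sign
this inner product has, assigning a and b to κ and -κ suitably bounds it by the two suprema, and κ ↦
-κ preserves the average. -/
theorem expect_sign_iSup_le {ι : Type*} [Finite ι] [Nonempty ι] {K : Type*} [Fintype K]
    [DecidableEq K] (h r : ι → ℝ) (v : ι → K → ℝ)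
    (hL : ∀ a b, |h a - h b| ≤ √(∑ k, (v a k - v b k) ^ 2)) :
    𝔼 s : ℤˣ, ⨆ a, (((s : ℤ) : ℝ) * h a + r a) ≤
      𝔼 κ : K → ℤˣ, ⨆ a, (2 * ∑ k, ((κ k : ℤ) : ℝ) * v a k + r a) := by
  set Φ : (K → ℤˣ) → ℝ := fun κ => ⨆ a, (2 * ∑ k, ((κ k : ℤ) : ℝ) * v a k + r a) with hΦ
  obtain ⟨a, ha⟩ := exists_eq_ciSup_of_finite (f := fun a => (((1 : ℤˣ) : ℤ) : ℝ) * h a + r a)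
  obtain ⟨b, hb⟩ := exists_eq_ciSup_of_finite (f := fun a => (((-1 : ℤˣ) : ℤ) : ℝ) * h a + r a)
  rw [expect_units, ← ha, ← hb]
  have hpt : ∀ κ : K → ℤˣ,
      2 * |∑ k, ((κ k : ℤ) : ℝ) * (v a k - v b k)| + (r a + r b) ≤ Φ κ + Φ (-κ) := fun κ => by
    have e : ∑ k, ((κ k : ℤ) : ℝ) * (v a k - v b k) =
        ∑ k, ((κ k : ℤ) : ℝ) * v a k - ∑ k, ((κ k : ℤ) : ℝ) * v b k := by
      rw [← Finset.sum_sub_distrib]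
      exact Finset.sum_congr rfl fun k _ => by ring
    have en : ∀ c, ∑ k, ((((-κ) k : ℤˣ) : ℤ) : ℝ) * v c k =
        -∑ k, ((κ k : ℤ) : ℝ) * v c k := fun c => by
      rw [← Finset.sum_neg_distrib]
      exact Finset.sum_congr rfl fun k _ => by simp
    have p : ∀ c, 2 * ∑ k, ((κ k : ℤ) : ℝ) * v c k + r c ≤ Φ κ := fun c =>
      le_iSup_finite (fun a => 2 * ∑ k, ((κ k : ℤ) : ℝ) * v a k + r a) c
    have q : ∀ c, 2 * -∑ k, ((κ k : ℤ) : ℝ) * v c k + r c ≤ Φ (-κ) := fun c => by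
      rw [← en]
      exact le_iSup_finite (fun a => 2 * ∑ k, ((((-κ) k : ℤˣ) : ℤ) : ℝ) * v a k + r a) c
    rw [e]
    rcases abs_cases (∑ k, ((κ k : ℤ) : ℝ) * v a k - ∑ k, ((κ k : ℤ) : ℝ) * v b k) with h | h
    · linarith [p a, q b]
    · linarith [p b, q a]
  have h1 := expect_le_expect_univ hpt
  rw [Finset.expect_add_distrib, Fintype.expect_const, ← Finset.mul_expect,
    Finset.expect_add_distrib, expect_signs_neg] at h1
  have h2 := (le_abs_self _).trans ((hL a b).trans (sqrt_sum_sq_le fun k => v a k - v b k))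
  push_cast
  linarith

/-- The vector-valued contraction principle for Rademacher averages. -/
theorem expect_contraction {ι : Type*} [Finite ι] [Nonempty ι] {K : Type*} [Fintype K]
    [DecidableEq K] {N : ℕ} (h : Fin N → ι → ℝ) (v : Fin N → ι → K → ℝ) (r : ι → ℝ)
    (hL : ∀ i a b, |h i a - h i b| ≤ √(∑ k, (v i a k - v i b k) ^ 2)) :
    𝔼 ε : Fin N → ℤˣ, ⨆ a, (∑ i, ((ε i : ℤ) : ℝ) * h i a + r a) ≤
      𝔼 κ : Fin N → K → ℤˣ, ⨆ a, (∑ i, 2 * ∑ k, ((κ i k : ℤ) : ℝ) * v i a k + r a) := by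
  induction N generalizing r with
  | zero => simp
  | succ N ih =>
    rw [expect_fin_succ, expect_fin_succ fun κ : Fin (N + 1) → K → ℤˣ =>
      ⨆ a, (∑ i, 2 * ∑ k, ((κ i k : ℤ) : ℝ) * v i a k + r a)]
    simp only [Fin.sum_univ_succ, Fin.cons_zero, Fin.cons_succ]
    calc _ = 𝔼 s : ℤˣ, 𝔼 ε : Fin N → ℤˣ, ⨆ a, (∑ i : Fin N, ((ε i : ℤ) : ℝ) * h i.succ a
            + (((s : ℤ) : ℝ) * h 0 a + r a)) := by
          refine Finset.expect_congr rfl fun s _ => Finset.expect_congr rfl fun ε _ => ?_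
          exact iSup_congr fun a => by ring
      _ ≤ 𝔼 s : ℤˣ, 𝔼 κ : Fin N → K → ℤˣ,
            ⨆ a, (∑ i : Fin N, 2 * ∑ k, ((κ i k : ℤ) : ℝ) * v i.succ a k
            + (((s : ℤ) : ℝ) * h 0 a + r a)) :=
          expect_le_expect_univ fun s => ih (fun i => h i.succ) (fun i => v i.succ) _
            fun i => hL i.succ
      _ = 𝔼 κ : Fin N → K → ℤˣ, 𝔼 s : ℤˣ, ⨆ a, (((s : ℤ) : ℝ) * h 0 a
            + (∑ i : Fin N, 2 * ∑ k, ((κ i k : ℤ) : ℝ) * v i.succ a k + r a)) := by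
          rw [Finset.expect_comm]
          refine Finset.expect_congr rfl fun s _ => Finset.expect_congr rfl fun ε _ => ?_
          exact iSup_congr fun a => by ring
      _ ≤ 𝔼 κ : Fin N → K → ℤˣ, 𝔼 κ₀ : K → ℤˣ, ⨆ a, (2 * ∑ k, ((κ₀ k : ℤ) : ℝ) * v 0 a k
            + (∑ i : Fin N, 2 * ∑ k, ((κ i k : ℤ) : ℝ) * v i.succ a k + r a)) :=
          expect_le_expect_univ fun κ => expect_sign_iSup_le _ _ _ (hL 0)
      _ = _ := by
          rw [Finset.expect_comm]
          refine Finset.expect_congr rfl fun s _ => Finset.expect_congr rfl fun ε _ => ?_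
          exact iSup_congr fun a => by ring

/-- Massart's finite class lemma, for absolute values. -/
theorem expect_iSup_abs_le {M : Type*} [Fintype M] [Nonempty M] {J : Type*} [Fintype J]
    [DecidableEq J] (g : M → J → ℝ) {V : ℝ} (hV : 0 < V) (hg : ∀ m, ∑ j, g m j ^ 2 ≤ V) :
    𝔼 κ : J → ℤˣ, ⨆ m, |∑ j, ((κ j : ℤ) : ℝ) * g m j| ≤
      √(2 * V * Real.log (2 * Fintype.card M)) := by
  set l := Real.log (2 * Fintype.card M) with hl
  have hM : (1 : ℝ) ≤ Fintype.card M := by exact_mod_cast Fintype.card_pos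
  have hl0 : 0 < l := Real.log_pos (by linarith)
  set E := 𝔼 κ : J → ℤˣ, ⨆ m, |∑ j, ((κ j : ℤ) : ℝ) * g m j| with hE
  set q := √(2 * V * l) with hq
  have hq0 : 0 < q := Real.sqrt_pos.2 (by positivity)
  have hq2 : q ^ 2 = 2 * V * l := Real.sq_sqrt (by positivity)
  -- The Chernoff parameter minimising l/t + tV/2, whose minimum is q.
  set t := q / V with ht
  have ht0 : 0 < t := div_pos hq0 hV
  have hone : ∀ m (u : ℝ), u ^ 2 = t ^ 2 →
      𝔼 κ : J → ℤˣ, Real.exp (u * ∑ j, ((κ j : ℤ) : ℝ) * g m j) ≤ Real.exp (t ^ 2 * V / 2) := by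
    intro m u hu
    have := expect_signs_exp_le fun j => u * g m j
    simp only [mul_pow, ← Finset.mul_sum, mul_left_comm _ u, hu] at this
    refine this.trans (Real.exp_le_exp.2 ?_)
    have := mul_le_mul_of_nonneg_left (hg m) (sq_nonneg t)
    linarith
  have hpt : ∀ κ : J → ℤˣ, Real.exp (t * ⨆ m, |∑ j, ((κ j : ℤ) : ℝ) * g m j|) ≤
      ∑ m, (Real.exp (t * ∑ j, ((κ j : ℤ) : ℝ) * g m j)
        + Real.exp (-t * ∑ j, ((κ j : ℤ) : ℝ) * g m j)) := fun κ => by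
    obtain ⟨m, hm⟩ := exists_eq_ciSup_of_finite (f := fun m => |∑ j, ((κ j : ℤ) : ℝ) * g m j|)
    rw [← hm]
    refine le_trans ?_ (Finset.single_le_sum (f := fun m =>
      Real.exp (t * ∑ j, ((κ j : ℤ) : ℝ) * g m j)
        + Real.exp (-t * ∑ j, ((κ j : ℤ) : ℝ) * g m j)) (fun _ _ => by positivity)
      (Finset.mem_univ m))
    rcases abs_cases (∑ j, ((κ j : ℤ) : ℝ) * g m j) with h | h
    · simp only [h.1]
      linarith [Real.exp_pos (-t * ∑ j, ((κ j : ℤ) : ℝ) * g m j)]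
    · simp only [h.1, mul_neg, neg_mul]
      linarith [Real.exp_pos (t * ∑ j, ((κ j : ℤ) : ℝ) * g m j)]
  have h1 : Real.exp (t * E) ≤ Real.exp (l + t ^ 2 * V / 2) := by
    calc Real.exp (t * E) ≤ 𝔼 κ : J → ℤˣ, Real.exp (t * ⨆ m, |∑ j, ((κ j : ℤ) : ℝ) * g m j|) := by
          rw [hE, Finset.mul_expect]
          exact exp_expect_le _
      _ ≤ 𝔼 κ : J → ℤˣ, ∑ m, (Real.exp (t * ∑ j, ((κ j : ℤ) : ℝ) * g m j)
        + Real.exp (-t * ∑ j, ((κ j : ℤ) : ℝ) * g m j)) := expect_le_expect_univ hpt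
      _ = ∑ m, (𝔼 κ : J → ℤˣ, Real.exp (t * ∑ j, ((κ j : ℤ) : ℝ) * g m j)
        + 𝔼 κ : J → ℤˣ, Real.exp (-t * ∑ j, ((κ j : ℤ) : ℝ) * g m j)) := by
          rw [Finset.expect_sum_comm]
          exact Finset.sum_congr rfl fun m _ => Finset.expect_add_distrib _ _ _
      _ ≤ ∑ _m : M, 2 * Real.exp (t ^ 2 * V / 2) :=
          Finset.sum_le_sum fun m _ => by linarith [hone m t rfl, hone m (-t) (neg_sq t)]
      _ = Real.exp (l + t ^ 2 * V / 2) := by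
          rw [Real.exp_add, hl, Real.exp_log (by linarith)]
          simp
          ring
  have h2 := Real.exp_le_exp.1 h1
  have h3 : l + t ^ 2 * V / 2 = t * q := by
    have : l = q ^ 2 / (2 * V) := by rw [hq2]; field_simp
    rw [this, ht]
    field_simp
    ring
  rw [h3] at h2
  exact le_of_mul_le_mul_left h2 ht0

end SignAverage

/-! ### Uniform deviations of empirical means from Rademacher averages -/

namespace UniformDeviation

open SignAverage

/-- Flipping one sign moves the supremum by at most 2, since the functions take values in [0,1]; the
bounded differences inequality then applies with c = l. -/
theorem expect_exp_iSup_le {Z : Type*} {ι : Type*} [Finite ι] [Nonempty ι] {N : ℕ} {h : ι → Z → ℝ}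
    (h01 : ∀ a z, h a z ∈ Set.Icc (0 : ℝ) 1) (z : Fin N → Z) {B : ℝ} {l : ℝ} (hl : 0 ≤ l)
    (hB : 𝔼 ε : Fin N → ℤˣ, ⨆ a, ∑ i, ((ε i : ℤ) : ℝ) * h a (z i) ≤ B) :
    𝔼 ε : Fin N → ℤˣ, Real.exp (l * ⨆ a, ∑ i, ((ε i : ℤ) : ℝ) * h a (z i)) ≤
      Real.exp (l * B + N * l ^ 2 / 2) := by
  refine (expect_exp_le_of_bounded_differences l _ ?_).trans (Real.exp_le_exp.2 ?_)
  · intro i ε ε' hε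
    have key : ∀ ε ε' : Fin N → ℤˣ, (∀ j, j ≠ i → ε j = ε' j) →
        ⨆ a, ∑ i, ((ε i : ℤ) : ℝ) * h a (z i) ≤ (⨆ a, ∑ i, ((ε' i : ℤ) : ℝ) * h a (z i)) + 2 := by
      intro ε ε' hε
      refine ciSup_le fun a => ?_
      have h1 := le_iSup_finite (fun a => ∑ i, ((ε' i : ℤ) : ℝ) * h a (z i)) a
      have h2 : ∑ j, ((ε j : ℤ) : ℝ) * h a (z j) - ∑ j, ((ε' j : ℤ) : ℝ) * h a (z j) =
          (((ε i : ℤ) : ℝ) - ((ε' i : ℤ) : ℝ)) * h a (z i) := by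
        rw [← Finset.sum_sub_distrib]
        rw [Finset.sum_eq_single i (fun j _ hj => by rw [hε j hj]; ring) (by simp)]
        ring
      have h3 : (((ε i : ℤ) : ℝ) - ((ε' i : ℤ) : ℝ)) * h a (z i) ≤ 2 := by
        obtain ⟨p, q⟩ := h01 a (z i)
        rcases Int.units_eq_one_or (ε i) with e | e <;>
          rcases Int.units_eq_one_or (ε' i) with e' | e' <;> rw [e, e'] <;> push_cast <;> linarith
      linarith
    have k1 := key ε ε' hε
    have k2 := key ε' ε fun j hj => (hε j hj).symm
    rw [← mul_sub, abs_mul, abs_of_nonneg hl, mul_comm 2]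
    refine mul_le_mul_of_nonneg_left ?_ hl
    rw [abs_le]
    constructor <;> linarith
  · rw [← Finset.mul_expect]
    have := mul_le_mul_of_nonneg_left hB hl
    linarith

variable {Z : Type*} [MeasurableSpace Z] (μ : Measure Z) [IsProbabilityMeasure μ]

/-- Symmetrisation of the exponential moment of a uniform deviation. -/
theorem integral_exp_iSup_le {ι : Type*} [Finite ι] [Nonempty ι] {N : ℕ} {h : ι → Z → ℝ}
    (hm : ∀ a, Measurable (h a)) (h01 : ∀ a z, h a z ∈ Set.Icc (0 : ℝ) 1) {B : ℝ}
    (hB : ∀ z : Fin N → Z, 𝔼 ε : Fin N → ℤˣ, ⨆ a, ∑ i, ((ε i : ℤ) : ℝ) * h a (z i) ≤ B)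
    {l : ℝ} (hl : 0 ≤ l) :
    ∫ S, Real.exp (l * ⨆ a, ∑ i, (∫ z, h a z ∂μ - h a (S i))) ∂(Measure.pi fun _ : Fin N => μ) ≤
      Real.exp (2 * l * B + 2 * N * l ^ 2) := by
  set P := Measure.pi fun _ : Fin N => μ with hP
  set Ψ : (Fin N → Z) × (Fin N → Z) → ℝ := fun p =>
    Real.exp (l * ⨆ a, ∑ i, (h a (p.1 i) - h a (p.2 i))) with hΨ
  have habs : ∀ a z w, |h a z - h a w| ≤ 1 := fun a z w => by
    obtain ⟨p, q⟩ := h01 a z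
    obtain ⟨p', q'⟩ := h01 a w
    rw [abs_le]; constructor <;> linarith
  have hΨm : Measurable Ψ := by
    refine Real.measurable_exp.comp (Measurable.const_mul (Measurable.iSup fun a => ?_) l)
    refine Finset.measurable_sum _ fun i _ => ?_
    exact ((hm a).comp ((measurable_pi_apply i).comp measurable_fst)).sub
      ((hm a).comp ((measurable_pi_apply i).comp measurable_snd))
  have hle : ∀ (f : ι → Fin N → ℝ), (∀ a i, |f a i| ≤ 1) → ⨆ a, ∑ i, f a i ≤ N := fun f hf =>
    ciSup_le fun a => (Finset.sum_le_sum fun i _ => (abs_le.1 (hf a i)).2).trans (by simp)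
  have hΨb : ∀ p, ‖Ψ p‖ ≤ Real.exp (l * N) := fun p => by
    rw [Real.norm_of_nonneg (Real.exp_pos _).le]
    exact Real.exp_le_exp.2 (mul_le_mul_of_nonneg_left (hle _ fun a i => habs _ _ _) hl)
  have hΨi : ∀ (ν : Measure ((Fin N → Z) × (Fin N → Z))) [IsProbabilityMeasure ν],
      Integrable Ψ ν := fun ν _ =>
    Integrable.of_bound hΨm.aestronglyMeasurable _ (Filter.Eventually.of_forall hΨb)
  have hint : ∀ a, Integrable (h a) μ := fun a =>
    Integrable.of_bound (hm a).aestronglyMeasurable 1 (Filter.Eventually.of_forall fun z => by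
      rw [Real.norm_of_nonneg (h01 a z).1]; exact (h01 a z).2)
  have hev : ∀ i, MeasurePreserving (Function.eval i) P μ := fun i =>
    measurePreserving_eval (fun _ => μ) i
  -- the ghost sample
  have step1 : ∀ S : Fin N → Z, Real.exp (l * ⨆ a, ∑ i, (∫ z, h a z ∂μ - h a (S i))) ≤
      ∫ S', Ψ (S', S) ∂P := by
    intro S
    obtain ⟨a, ha⟩ := exists_eq_ciSup_of_finite
      (f := fun a => ∑ i, (∫ z, h a z ∂μ - h a (S i)))
    rw [← ha]
    set f : (Fin N → Z) → ℝ := fun S' => l * ∑ i, (h a (S' i) - h a (S i)) with hf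
    have hfi : ∀ i, Integrable (fun S' : Fin N → Z => h a (S' i)) P := fun i =>
      (hev i).integrable_comp_of_integrable (hint a)
    have hfint : Integrable f P :=
      (integrable_finsetSum _ fun i _ => (hfi i).sub (integrable_const _)).const_mul l
    have e : l * ∑ i, (∫ z, h a z ∂μ - h a (S i)) = ∫ S', f S' ∂P := by
      have hs := integral_finsetSum (μ := P) Finset.univ
        (f := fun (i : Fin N) (S' : Fin N → Z) => h a (S' i) - h a (S i))
        fun i _ => (hfi i).sub (integrable_const _)
      rw [hf, integral_const_mul, hs]
      congr 1
      refine Finset.sum_congr rfl fun i _ => ?_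
      rw [integral_sub (hfi i) (integrable_const _), integral_const]
      simp only [probReal_univ, one_smul]
      congr 1
      rw [← (hev i).map_eq, integral_map (hev i).measurable.aemeasurable
        (hm a).aestronglyMeasurable]
    have hfm : Measurable f := by
      refine Measurable.const_mul (Finset.measurable_sum _ fun i _ => ?_) l
      exact ((hm a).comp (measurable_pi_apply i)).sub measurable_const
    have hfle : ∀ S', Real.exp (f S') ≤ Ψ (S', S) := fun S' =>
      Real.exp_le_exp.2 (mul_le_mul_of_nonneg_left
        (le_iSup_finite (fun a => ∑ i, (h a (S' i) - h a (S i))) a) hl)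
    have hΨS : Integrable (fun S' => Ψ (S', S)) P :=
      Integrable.of_bound (hΨm.comp measurable_prodMk_right).aestronglyMeasurable _
        (Filter.Eventually.of_forall fun S' => hΨb _)
    have hei : Integrable (Real.exp ∘ f) P :=
      hΨS.mono' (Real.measurable_exp.comp hfm).aestronglyMeasurable
        (Filter.Eventually.of_forall fun S' => by
          rw [Function.comp_apply, Real.norm_of_nonneg (Real.exp_pos _).le]; exact hfle S')
    rw [e]
    refine (convexOn_exp.map_integral_le Real.continuous_exp.continuousOn isClosed_univ
      (by simp) hfint hei).trans ?_
    exact integral_mono hei hΨS hfle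
  -- pass to pairs
  set Q := Measure.pi fun _ : Fin N => μ.prod μ with hQ
  have hpair := measurePreserving_arrowProdEquivProdArrow Z Z (Fin N) (fun _ => μ) (fun _ => μ)
  have hS : ∫ S, ∫ S', Ψ (S', S) ∂P ∂P = ∫ p, Ψ (fun i => (p i).1, fun i => (p i).2) ∂Q := by
    have h1 : ∫ S, ∫ S', Ψ (S', S) ∂P ∂P = ∫ p, Ψ p ∂(P.prod P) := by
      rw [integral_prod_symm _ (hΨi _)]
    rw [h1, ← hpair.map_eq, integral_map hpair.measurable.aemeasurable
      hΨm.aestronglyMeasurable]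
    rfl
  -- swap coordinates
  have hsw : ∀ ε : Fin N → ℤˣ, ∫ p, Ψ (fun i => (p i).1, fun i => (p i).2) ∂Q =
      ∫ p, Real.exp (l * ⨆ a, ∑ i, ((ε i : ℤ) : ℝ) * (h a (p i).1 - h a (p i).2)) ∂Q := by
    intro ε
    -- Exchanging the two points of the i-th pair preserves the product measure and changes the sign
    -- of the i-th difference.
    have hmp : MeasurePreserving
        (fun (p : Fin N → Z × Z) i => if ε i = 1 then p i else (p i).swap) Q Q := by
      refine measurePreserving_pi (fun _ => μ.prod μ) (fun _ => μ.prod μ)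
        (f := fun i q => if ε i = 1 then q else q.swap) fun i => ?_
      by_cases hi : ε i = 1
      · simp only [hi, if_true]
        exact MeasurePreserving.id _
      · simp only [hi, if_false]
        exact ⟨measurable_swap, Measure.prod_swap⟩
    have hm2 : Measurable fun p : Fin N → Z × Z => Ψ (fun i => (p i).1, fun i => (p i).2) :=
      hΨm.comp hpair.measurable
    conv_lhs => rw [← hmp.map_eq]
    rw [integral_map hmp.measurable.aemeasurable hm2.aestronglyMeasurable]
    refine integral_congr_ae (Filter.Eventually.of_forall fun p => ?_)
    simp only [hΨ]
    congr 2
    refine iSup_congr fun a => Finset.sum_congr rfl fun i _ => ?_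
    rcases Int.units_eq_one_or (ε i) with e | e
    · simp [e]
    · have : ¬ ((-1 : ℤˣ) = 1) := by decide
      simp [e, this]
  have hsm : ∀ ε : Fin N → ℤˣ, Integrable (fun p : Fin N → Z × Z =>
      Real.exp (l * ⨆ a, ∑ i, ((ε i : ℤ) : ℝ) * (h a (p i).1 - h a (p i).2))) Q := by
    intro ε
    refine Integrable.of_bound (Measurable.aestronglyMeasurable ?_) (Real.exp (l * N))
      (Filter.Eventually.of_forall fun p => ?_)
    · refine Real.measurable_exp.comp (Measurable.const_mul (Measurable.iSup fun a => ?_) l)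
      refine Finset.measurable_sum _ fun i _ => Measurable.const_mul ?_ _
      exact ((hm a).comp (measurable_fst.comp (measurable_pi_apply i))).sub
        ((hm a).comp (measurable_snd.comp (measurable_pi_apply i)))
    · rw [Real.norm_of_nonneg (Real.exp_pos _).le]
      refine Real.exp_le_exp.2 (mul_le_mul_of_nonneg_left (hle _ fun a i => ?_) hl)
      rcases Int.units_eq_one_or (ε i) with e | e
      · simpa [e] using habs a (p i).1 (p i).2
      · simpa [e] using habs a (p i).2 (p i).1
  have hptw : ∀ p : Fin N → Z × Z, 𝔼 ε : Fin N → ℤˣ,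
      Real.exp (l * ⨆ a, ∑ i, ((ε i : ℤ) : ℝ) * (h a (p i).1 - h a (p i).2)) ≤
      Real.exp (2 * l * B + 2 * N * l ^ 2) := by
    intro p
    set A : (Fin N → ℤˣ) → ℝ := fun ε => ⨆ a, ∑ i, ((ε i : ℤ) : ℝ) * h a (p i).1 with hA
    set A' : (Fin N → ℤˣ) → ℝ := fun ε => ⨆ a, ∑ i, ((ε i : ℤ) : ℝ) * h a (p i).2 with hA'
    -- The supremum of differences splits into one supremum per sample, and e^x e^y ≤ (e^{2x} +
    -- e^{2y})/2 decouples the samples at the price of doubling l.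
    have h1 : ∀ ε : Fin N → ℤˣ,
        Real.exp (l * ⨆ a, ∑ i, ((ε i : ℤ) : ℝ) * (h a (p i).1 - h a (p i).2)) ≤
        (Real.exp (2 * l * A ε) + Real.exp (2 * l * A' (-ε))) / 2 := by
      intro ε
      have h2 : ⨆ a, ∑ i, ((ε i : ℤ) : ℝ) * (h a (p i).1 - h a (p i).2) ≤ A ε + A' (-ε) := by
        refine ciSup_le fun a => ?_
        have p1 := le_iSup_finite (fun a => ∑ i, ((ε i : ℤ) : ℝ) * h a (p i).1) a
        have p2 := le_iSup_finite (fun a => ∑ i, ((((-ε) i : ℤˣ) : ℤ) : ℝ) * h a (p i).2) a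
        refine le_trans (le_of_eq ?_) (add_le_add p1 p2)
        rw [← Finset.sum_add_distrib]
        refine Finset.sum_congr rfl fun i _ => ?_
        simp
        ring
      have h3 := Real.exp_le_exp.2 (mul_le_mul_of_nonneg_left h2 hl)
      have e1 : Real.exp (l * (A ε + A' (-ε))) = Real.exp (l * A ε) * Real.exp (l * A' (-ε)) := by
        rw [← Real.exp_add]; ring_nf
      have e2 : ∀ x, Real.exp (2 * l * x) = Real.exp (l * x) ^ 2 := fun x => by
        rw [← Real.exp_nat_mul]; push_cast; ring_nf
      rw [e2, e2]
      rw [e1] at h3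
      nlinarith [sq_nonneg (Real.exp (l * A ε) - Real.exp (l * A' (-ε)))]
    refine (expect_le_expect_univ h1).trans ?_
    rw [← Finset.expect_div, Finset.expect_add_distrib,
      expect_signs_neg fun ε => Real.exp (2 * l * A' ε)]
    have b1 := expect_exp_iSup_le h01 (fun i => (p i).1) (l := 2 * l) (by linarith)
      (hB fun i => (p i).1)
    have b2 := expect_exp_iSup_le h01 (fun i => (p i).2) (l := 2 * l) (by linarith)
      (hB fun i => (p i).2)
    rw [show (N : ℝ) * (2 * l) ^ 2 / 2 = 2 * N * l ^ 2 by ring] at b1 b2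
    linarith
  calc _ ≤ ∫ S, ∫ S', Ψ (S', S) ∂P ∂P := by
        refine integral_mono_of_nonneg (Filter.Eventually.of_forall fun _ => (Real.exp_pos _).le)
          (hΨi (P.prod P)).integral_prod_right (Filter.Eventually.of_forall step1)
    _ = 𝔼 ε : Fin N → ℤˣ, ∫ p,
          Real.exp (l * ⨆ a, ∑ i, ((ε i : ℤ) : ℝ) * (h a (p i).1 - h a (p i).2)) ∂Q := by
        rw [hS, ← Fintype.expect_const (ι := Fin N → ℤˣ)
          (∫ p, Ψ (fun i => (p i).1, fun i => (p i).2) ∂Q)]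
        exact Finset.expect_congr rfl fun ε _ => hsw ε
    _ = ∫ p, 𝔼 ε : Fin N → ℤˣ,
          Real.exp (l * ⨆ a, ∑ i, ((ε i : ℤ) : ℝ) * (h a (p i).1 - h a (p i).2)) ∂Q := by
        simp_rw [Fintype.expect_eq_sum_div_card]
        rw [integral_div, integral_finsetSum _ fun ε _ => hsm ε]
    _ ≤ ∫ _p, Real.exp (2 * l * B + 2 * N * l ^ 2) ∂Q := by
        refine integral_mono ?_ (integrable_const _) hptw
        simp_rw [Fintype.expect_eq_sum_div_card]
        exact (integrable_finsetSum _ fun ε _ => hsm ε).div_const _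
    _ = _ := by simp

theorem measure_exists_ge_le_of_finite {ι : Type*} [Finite ι] [Nonempty ι] {N : ℕ} (hN : 1 ≤ N)
    {h : ι → Z → ℝ} (hm : ∀ a, Measurable (h a)) (h01 : ∀ a z, h a z ∈ Set.Icc (0 : ℝ) 1) {B : ℝ}
    (hB : ∀ z : Fin N → Z, 𝔼 ε : Fin N → ℤˣ, ⨆ a, ∑ i, ((ε i : ℤ) : ℝ) * h a (z i) ≤ B)
    {s : ℝ} (hs : 0 ≤ s) :
    (Measure.pi fun _ : Fin N => μ) {S | ∃ a, 2 * B + s ≤ ∑ i, (∫ z, h a z ∂μ - h a (S i))} ≤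
      ENNReal.ofReal (Real.exp (-s ^ 2 / (8 * N))) := by
  have hN0 : (0 : ℝ) < N := by exact_mod_cast hN
  set Φ : (Fin N → Z) → ℝ := fun S => ⨆ a, ∑ i, (∫ z, h a z ∂μ - h a (S i)) with hΦ
  have hset : {S : Fin N → Z | ∃ a, 2 * B + s ≤ ∑ i, (∫ z, h a z ∂μ - h a (S i))} ⊆
      {S | 2 * B + s ≤ Φ S} := fun S ⟨a, ha⟩ =>
    ha.trans (le_iSup_finite (fun a => ∑ i, (∫ z, h a z ∂μ - h a (S i))) a)
  refine (measure_mono hset).trans ?_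
  -- Minimises -ls + 2Nl²; the minimum is -s²/(8N).
  set l := s / (4 * N) with hl
  have hl0 : 0 ≤ l := by positivity
  have hi01 : ∀ a, ∫ z, h a z ∂μ ≤ 1 := fun a => by
    have := integral_mono_of_nonneg (μ := μ) (f := h a) (g := fun _ => (1 : ℝ))
      (Filter.Eventually.of_forall fun z => (h01 a z).1) (integrable_const _)
      (Filter.Eventually.of_forall fun z => (h01 a z).2)
    simpa using this
  have hΦm : Measurable Φ := Measurable.iSup fun a => Finset.measurable_sum _ fun i _ =>
    measurable_const.sub ((hm a).comp (measurable_pi_apply i))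
  have hint : Integrable (fun S => Real.exp (l * Φ S)) (Measure.pi fun _ : Fin N => μ) := by
    refine Integrable.of_bound (Real.measurable_exp.comp (hΦm.const_mul l)).aestronglyMeasurable
      (Real.exp (l * N)) (Filter.Eventually.of_forall fun S => ?_)
    rw [Real.norm_of_nonneg (Real.exp_pos _).le]
    refine Real.exp_le_exp.2 (mul_le_mul_of_nonneg_left (ciSup_le fun a => ?_) hl0)
    refine (Finset.sum_le_sum fun i _ => show _ ≤ (1 : ℝ) from ?_).trans (by simp)
    linarith [hi01 a, (h01 a (S i)).1]
  have h1 := ProbabilityTheory.measure_ge_le_exp_mul_mgf (2 * B + s) hl0 hint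
  have h2 := integral_exp_iSup_le μ hm h01 hB hl0
  rw [← ENNReal.ofReal_toReal (measure_ne_top (Measure.pi fun _ : Fin N => μ) _)]
  refine ENNReal.ofReal_le_ofReal (h1.trans ?_)
  calc _ ≤ Real.exp (-l * (2 * B + s)) * Real.exp (2 * l * B + 2 * N * l ^ 2) :=
        mul_le_mul_of_nonneg_left h2 (Real.exp_pos _).le
    _ = _ := by
        rw [← Real.exp_add, hl]
        congr 1
        field_simp
        ring

/-- Uniform deviation inequality for a class of functions that depend continuously on a parameter
in a second countable space. -/
theorem measure_exists_gt_le {T : Type*} [TopologicalSpace T] [SecondCountableTopology T] {N : ℕ}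
    (hN : 1 ≤ N) {h : T → Z → ℝ} (hm : ∀ w, Measurable (h w))
    (h01 : ∀ w z, h w z ∈ Set.Icc (0 : ℝ) 1) (hc : ∀ z, Continuous fun w => h w z) {B : ℝ}
    (hB : ∀ (m : ℕ) (w : Fin (m + 1) → T) (z : Fin N → Z),
      𝔼 ε : Fin N → ℤˣ, ⨆ a, ∑ i, ((ε i : ℤ) : ℝ) * h (w a) (z i) ≤ B)
    {s : ℝ} (hs : 0 ≤ s) :
    (Measure.pi fun _ : Fin N => μ) {S | ∃ w, 2 * B + s < ∑ i, (∫ z, h w z ∂μ - h w (S i))} ≤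
      ENNReal.ofReal (Real.exp (-s ^ 2 / (8 * N))) := by
  rcases isEmpty_or_nonempty T with hT | hT
  · simp
  set u := TopologicalSpace.denseSeq T with hu
  have hcont : ∀ S : Fin N → Z, Continuous fun w => ∑ i, (∫ z, h w z ∂μ - h w (S i)) := fun S => by
    refine continuous_finsetSum _ fun i _ => Continuous.sub ?_ (hc _)
    refine continuous_of_dominated (bound := fun _ => 1)
      (fun w => (hm w).aestronglyMeasurable) (fun w => Filter.Eventually.of_forall fun z => ?_)
      (integrable_const _) (Filter.Eventually.of_forall hc)
    rw [Real.norm_of_nonneg (h01 w z).1]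
    exact (h01 w z).2
  set A : ℕ → Set (Fin N → Z) := fun n =>
    {S | 2 * B + s ≤ ∑ i, (∫ z, h (u n) z ∂μ - h (u n) (S i))} with hA
  -- The strict inequality is an open condition on w, so it already holds at some point of the dense
  -- sequence.
  have hsub : {S : Fin N → Z | ∃ w, 2 * B + s < ∑ i, (∫ z, h w z ∂μ - h w (S i))} ⊆ ⋃ n, A n := by
    rintro S ⟨w, hw⟩
    obtain ⟨n, hn⟩ := (TopologicalSpace.denseRange_denseSeq T).exists_mem_open
      (isOpen_lt continuous_const (hcont S)) ⟨w, hw⟩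
    exact Set.mem_iUnion.2 ⟨n, (le_of_lt hn : 2 * B + s ≤ _)⟩
  refine (measure_mono hsub).trans ?_
  -- Continuity from below reduces to finite subclasses, for which the bound is uniform in their
  -- size.
  rw [measure_iUnion_eq_iSup_accumulate]
  refine iSup_le fun m => ?_
  refine (measure_mono ?_).trans (measure_exists_ge_le_of_finite μ hN
    (h := fun a : Fin (m + 1) => h (u a)) (fun a => hm _) (fun a => h01 _)
    (fun z => hB m (fun a => u a) z) hs)
  intro S hS
  obtain ⟨k, hk, hS⟩ := Set.mem_accumulate.1 hS
  exact ⟨⟨k, Nat.lt_succ_of_le hk⟩, hS⟩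

end UniformDeviation

/-! ### Pauli strings and process matrices -/

namespace PMModel

/-! ### Algebra of Pauli strings. -/

theorem pauliOne_mul (a b : Fin 4) :
    ∃ (c : Fin 4) (z : ℂ), ‖z‖ = 1 ∧ pauliOne a * pauliOne b = z • pauliOne c := by
  have hI : ∀ (c : Fin 4), pauliOne a * pauliOne b = (1 : ℂ) • pauliOne c →
      ∃ (c : Fin 4) (z : ℂ), ‖z‖ = 1 ∧ pauliOne a * pauliOne b = z • pauliOne c :=
    fun c h => ⟨c, 1, by simp, h⟩
  have hi : ∀ (c : Fin 4), pauliOne a * pauliOne b = Complex.I • pauliOne c →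
      ∃ (c : Fin 4) (z : ℂ), ‖z‖ = 1 ∧ pauliOne a * pauliOne b = z • pauliOne c :=
    fun c h => ⟨c, Complex.I, by simp, h⟩
  have hj : ∀ (c : Fin 4), pauliOne a * pauliOne b = (-Complex.I) • pauliOne c →
      ∃ (c : Fin 4) (z : ℂ), ‖z‖ = 1 ∧ pauliOne a * pauliOne b = z • pauliOne c :=
    fun c h => ⟨c, -Complex.I, by simp, h⟩
  fin_cases a <;> fin_cases b
  -- The multiplication table of I, X, Y, Z, row by row: the label of the product and its phase 1, i
  -- or -i.
  on_goal 1 => apply hI 0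
  on_goal 2 => apply hI 1
  on_goal 3 => apply hI 2
  on_goal 4 => apply hI 3
  on_goal 5 => apply hI 1
  on_goal 6 => apply hI 0
  on_goal 7 => apply hi 3
  on_goal 8 => apply hj 2
  on_goal 9 => apply hI 2
  on_goal 10 => apply hj 3
  on_goal 11 => apply hI 0
  on_goal 12 => apply hi 1
  on_goal 13 => apply hI 3
  on_goal 14 => apply hi 2
  on_goal 15 => apply hj 1
  on_goal 16 => apply hI 0
  all_goals
    ext i j
    fin_cases i <;> fin_cases j <;> simp [pauliOne]

theorem pauliOne_conjTranspose (a : Fin 4) : (pauliOne a).conjTranspose = pauliOne a := by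
  ext i j
  fin_cases a <;> fin_cases i <;> fin_cases j <;> simp [pauliOne]

theorem pauliOne_mul_self (a : Fin 4) : pauliOne a * pauliOne a = 1 := by
  ext i j
  fin_cases a <;> fin_cases i <;> fin_cases j <;> simp [pauliOne]

theorem sum_pauliOne_mul_pauliOne (a b : Fin 4) :
    ∑ i, ∑ j, pauliOne a i j * pauliOne b j i = if a = b then 2 else 0 := by
  fin_cases a <;> fin_cases b <;> simp [pauliOne, Fin.sum_univ_two] <;> norm_num

/-- The completeness relation of the Pauli basis; its n-fold product is the depolarizing identity
`sum_pauli_mul_mul_pauli`. -/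
theorem sum_pauliOne_twirl (a b c e : Fin 2) :
    ∑ p, pauliOne p a c * pauliOne p e b = if a = b ∧ c = e then 2 else 0 := by
  fin_cases a <;> fin_cases b <;> fin_cases c <;> fin_cases e <;>
    simp [pauliOne, Fin.sum_univ_four] <;> norm_num

variable {n : ℕ}

theorem sum_prod_pi_eq {ι α : Type*} [Fintype ι] [DecidableEq ι] [Fintype α]
    (F : ι → α → ℂ) : ∑ f : ι → α, ∏ i, F i (f i) = ∏ i, ∑ x, F i x := by
  rw [Finset.prod_univ_sum, Fintype.piFinset_univ]

theorem pauli_mul_apply (A B : PauliIdx n) (a b : Basis n) :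
    (pauli A * pauli B) a b = ∏ i, (pauliOne (A i) * pauliOne (B i)) (a i) (b i) := by
  simp only [Matrix.mul_apply, pauli, Matrix.of_apply, ← Finset.prod_mul_distrib]
  exact sum_prod_pi_eq fun i x => pauliOne (A i) (a i) x * pauliOne (B i) x (b i)

theorem pauli_mul (A B : PauliIdx n) :
    ∃ (C : PauliIdx n) (z : ℂ), ‖z‖ = 1 ∧ pauli A * pauli B = z • pauli C := by
  choose C z hz h using fun i => pauliOne_mul (A i) (B i)
  refine ⟨C, ∏ i, z i, by simp [hz], ?_⟩
  ext a b
  rw [pauli_mul_apply]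
  simp [h, pauli, Finset.prod_mul_distrib]

theorem pauli_mul_self (A : PauliIdx n) : pauli A * pauli A = 1 := by
  ext a b
  rw [pauli_mul_apply]
  simp only [pauliOne_mul_self, Matrix.one_apply, Finset.prod_boole]
  simp [funext_iff]

theorem pauli_conjTranspose (A : PauliIdx n) : (pauli A).conjTranspose = pauli A := by
  ext a b
  simp only [Matrix.conjTranspose_apply, pauli, Matrix.of_apply, star_prod]
  exact Finset.prod_congr rfl fun i _ => congrFun (congrFun (pauliOne_conjTranspose (A i)) _) _

theorem pauli_zero : pauli (0 : PauliIdx n) = 1 := by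
  ext a b
  have : pauliOne 0 = 1 := by
    ext i j
    fin_cases i <;> fin_cases j <;> simp [pauliOne]
  simp only [pauli, Matrix.of_apply, Pi.zero_apply, this, Matrix.one_apply, Finset.prod_boole]
  simp [funext_iff]

theorem trace_pauli_mul_pauli (A B : PauliIdx n) :
    (pauli A * pauli B).trace = if A = B then 2 ^ n else 0 := by
  simp only [Matrix.trace, Matrix.diag_apply, pauli_mul_apply]
  rw [sum_prod_pi_eq fun i x => (pauliOne (A i) * pauliOne (B i)) x x]
  simp only [Matrix.mul_apply, sum_pauliOne_mul_pauliOne]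
  by_cases h : A = B
  · simp [h]
  · obtain ⟨i, hi⟩ := Function.ne_iff.1 h
    rw [if_neg h]
    exact Finset.prod_eq_zero (Finset.mem_univ i) (if_neg hi)

theorem sum_pauli_twirl (a b c e : Basis n) :
    ∑ A : PauliIdx n, pauli A a c * pauli A e b = if a = b ∧ c = e then 2 ^ n else 0 := by
  simp only [pauli, Matrix.of_apply, ← Finset.prod_mul_distrib]
  rw [sum_prod_pi_eq fun i p => pauliOne p (a i) (c i) * pauliOne p (e i) (b i)]
  simp only [sum_pauliOne_twirl]
  by_cases h : a = b ∧ c = e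
  · simp [h]
  · rw [if_neg h]
    have : ∃ i, ¬ (a i = b i ∧ c i = e i) := by
      by_contra! h'
      exact h ⟨funext fun i => (h' i).1, funext fun i => (h' i).2⟩
    obtain ⟨i, hi⟩ := this
    exact Finset.prod_eq_zero (Finset.mem_univ i) (if_neg hi)

theorem sum_pauli_mul_mul_pauli (X : Op n) :
    ∑ A : PauliIdx n, pauli A * X * pauli A = (2 ^ n * X.trace) • (1 : Op n) := by
  ext a b
  simp only [Matrix.sum_apply, Matrix.mul_apply, Finset.sum_mul, Matrix.smul_apply, smul_eq_mul]
  rw [Finset.sum_comm]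
  have : ∀ e, ∑ A : PauliIdx n, ∑ c, pauli A a c * X c e * pauli A e b =
      if a = b then 2 ^ n * X e e else 0 := fun e => by
    rw [Finset.sum_comm]
    have : ∀ c, ∑ A : PauliIdx n, pauli A a c * X c e * pauli A e b =
        (if a = b ∧ c = e then 2 ^ n else 0) * X c e := fun c => by
      rw [← sum_pauli_twirl, Finset.sum_mul]
      exact Finset.sum_congr rfl fun A _ => by ring
    simp only [this]
    by_cases h : a = b <;> simp [h]
  simp only [this, Matrix.trace, Matrix.diag_apply, Matrix.one_apply]
  by_cases h : a = b <;> simp [h, Finset.mul_sum]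

/-- The part of a layer map that is due to the weights. -/
noncomputable def weightMap (W : Weight n) (X : Op n) : Op n := ∑ A, ∑ B, W A B • (pauli A * X * pauli B)

/-- The maximally mixed state. -/
noncomputable def maxMixed (n : ℕ) : Op n := ((1 : ℂ) / 2 ^ n) • (1 : Op n)

/-- The diagonal part δ_{A,B}/4^n of the process matrix is the full Pauli twirl, which retains only
the trace. -/
theorem layer_eq (W : Weight n) (X : Op n) :
    layer W X = X.trace • maxMixed n + weightMap W X := by
  have : layer W X = ∑ A, ∑ B, processMatrix W A B • (pauli A * X * pauli B) := rfl
  rw [this, weightMap, maxMixed]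
  simp only [processMatrix, Matrix.of_apply, add_smul, Finset.sum_add_distrib]
  congr 1
  simp only [ite_smul, zero_smul, Finset.sum_ite_eq, Finset.mem_univ, if_true]
  rw [← Finset.smul_sum, sum_pauli_mul_mul_pauli, smul_smul, smul_smul]
  congr 1
  have : (4 : ℂ) ^ n = 2 ^ n * 2 ^ n := by rw [← mul_pow]; norm_num
  rw [this]
  field_simp

theorem trace_one_op : (1 : Op n).trace = 2 ^ n := by
  simp [Matrix.trace_one]

/-! ### What the channel property says about the process matrix. -/

theorem sum_processMatrix_diag (W : Weight n) (h : IsQuantumChannel (layer W)) :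
    ∑ A, processMatrix W A A = 1 := by
  have h1 := h.tracePreserving 1
  have h2 : layer W 1 = ∑ A, ∑ B, processMatrix W A B • (pauli A * pauli B) := by
    have : layer W 1 = ∑ A, ∑ B, processMatrix W A B • (pauli A * 1 * pauli B) := rfl
    simpa using this
  rw [h2] at h1
  simp only [Matrix.trace_sum, Matrix.trace_smul, trace_pauli_mul_pauli, trace_one_op, smul_eq_mul,
    mul_ite, mul_zero, Finset.sum_ite_eq, Finset.mem_univ, if_true] at h1
  rw [← Finset.sum_mul] at h1
  exact mul_right_cancel₀ (b := (2 : ℂ) ^ n) (by positivity) (by rw [h1, one_mul])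

/-- The Choi matrix of the layer is VχV†, where the columns of V are the vectorised Pauli strings.
These are orthogonal, V†V = 2^n, so χ is recovered from the positive semidefinite Choi matrix by a
congruence. -/
theorem processMatrix_posSemidef (W : Weight n) (h : IsQuantumChannel (layer W)) :
    (processMatrix W).PosSemidef := by
  set e := (Fintype.equivFin (Basis n)).symm with he
  -- The unnormalised maximally entangled vector, with the ancilla labelled through `e`.
  set v : Fin (Fintype.card (Basis n)) × Basis n → ℂ := fun p => if p.2 = e p.1 then 1 else 0
    with hv
  have hC := h.completelyPositive _ _ (Matrix.posSemidef_vecMulVec_self_star v)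
  set V : Matrix (Fin (Fintype.card (Basis n)) × Basis n) (PauliIdx n) ℂ :=
    Matrix.of fun p A => pauli A p.2 (e p.1) with hV
  have hVV : V.conjTranspose * V = (2 ^ n : ℂ) • (1 : Weight n) := by
    ext A B
    rw [Matrix.mul_apply, Fintype.sum_prod_type]
    simp only [Matrix.conjTranspose_apply, hV, Matrix.of_apply, Matrix.smul_apply]
    have : ∀ b a, star (pauli A a b) = pauli A b a := fun b a =>
      congrFun (congrFun (pauli_conjTranspose A) b) a
    simp only [this]
    rw [Equiv.sum_comp e fun b => ∑ a, pauli A b a * pauli B a b]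
    have h2 := trace_pauli_mul_pauli A B
    simp only [Matrix.trace, Matrix.diag_apply, Matrix.mul_apply] at h2
    rw [h2, Matrix.one_apply]
    simp
  have hamp : amplify _ (layer W) (Matrix.vecMulVec v (star v)) =
      V * processMatrix W * V.conjTranspose := by
    ext ⟨p, a⟩ ⟨q, b⟩
    have : (Matrix.of fun a b => Matrix.vecMulVec v (star v) (p, a) (q, b) : Op n) =
        Matrix.single (e p) (e q) 1 := by
      ext a b
      simp only [Matrix.of_apply, Matrix.vecMulVec_apply, hv, Pi.star_apply, Matrix.single_apply]
      by_cases h1 : a = e p <;> by_cases h2 : b = e q <;> simp [h1, h2, eq_comm]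
    simp only [amplify, Matrix.of_apply, this]
    have hl : layer W (Matrix.single (e p) (e q) 1) =
      ∑ A, ∑ B, processMatrix W A B • (pauli A * Matrix.single (e p) (e q) 1 * pauli B) := rfl
    rw [hl, Matrix.mul_apply]
    simp only [Matrix.sum_apply, Matrix.smul_apply, Matrix.conjTranspose_apply]
    rw [Finset.sum_comm]
    refine Finset.sum_congr rfl fun B _ => ?_
    rw [Matrix.mul_apply, Finset.sum_mul]
    refine Finset.sum_congr rfl fun A _ => ?_
    have hs : star (pauli B b (e q)) = pauli B (e q) b :=
      congrFun (congrFun (pauli_conjTranspose B) (e q)) b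
    have hm : (pauli A * Matrix.single (e p) (e q) 1 * pauli B : Op n) a b =
        pauli A a (e p) * pauli B (e q) b := by
      rw [Matrix.mul_apply]
      rw [Finset.sum_eq_single (e q)]
      · rw [Matrix.mul_single_apply_same, mul_one]
      · intro c _ hc
        rw [Matrix.mul_single_apply_of_ne _ _ _ _ _ (by exact hc), zero_mul]
      · simp
    simp only [hV, Matrix.of_apply]
    rw [hs, hm, smul_eq_mul]
    ring
  rw [hamp] at hC
  have h3 := hC.conjTranspose_mul_mul_same V
  have h4 : V.conjTranspose * (V * processMatrix W * V.conjTranspose) * V =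
      ((2 : ℂ) ^ n * 2 ^ n) • processMatrix W := by
    rw [show V.conjTranspose * (V * processMatrix W * V.conjTranspose) * V =
      (V.conjTranspose * V) * processMatrix W * (V.conjTranspose * V) by
        simp only [Matrix.mul_assoc], hVV]
    simp [smul_smul]
  rw [h4] at h3
  have h5 := h3.smul (α := ℂ) (a := ((2 : ℂ) ^ n * 2 ^ n)⁻¹) (by positivity)
  rwa [smul_smul, inv_mul_cancel₀ (by positivity), one_smul] at h5

theorem posSemidef_diag_real {ι : Type*} [Fintype ι] {M : Matrix ι ι ℂ} (h : M.PosSemidef) (i : ι) :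
    M i i = ((M i i).re : ℂ) ∧ 0 ≤ (M i i).re := by
  have := Complex.nonneg_iff.1 (h.diag_nonneg (i := i))
  exact ⟨Complex.ext (by simp) (by simp [this.2]), this.1⟩

/-- Nonnegativity of the 2×2 principal minor on i, j. -/
theorem posSemidef_norm_sq_le {ι : Type*} [Fintype ι] {M : Matrix ι ι ℂ} (h : M.PosSemidef)
    (i j : ι) : ‖M i j‖ ^ 2 ≤ (M i i).re * (M j j).re := by
  have h2 := (h.submatrix ![i, j]).det_nonneg
  rw [Matrix.det_fin_two] at h2
  simp only [Matrix.submatrix_apply, Matrix.cons_val_zero, Matrix.cons_val_one] at h2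
  have hs : M j i = star (M i j) := (h.1.apply j i).symm
  rw [hs, (posSemidef_diag_real h i).1, (posSemidef_diag_real h j).1] at h2
  have e : M i j * star (M i j) = ((‖M i j‖ ^ 2 : ℝ) : ℂ) := by
    rw [Complex.star_def, Complex.mul_conj, Complex.normSq_eq_norm_sq]
  rw [e] at h2
  have h3 := (Complex.nonneg_iff.1 h2).1
  simp only [Complex.sub_re, Complex.ofReal_re, ← Complex.ofReal_mul] at h3
  linarith

theorem normOneOne_nonneg (W : Weight n) : 0 ≤ normOneOne W :=
  Finset.sum_nonneg fun _ _ => Finset.sum_nonneg fun _ _ => norm_nonneg _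

/-! ### The chain norm and its relation to `betaPM`. -/

/-- `∑_j ∏_{ℓ ≥ j} ‖W_ℓ‖_{1,1}`, which bounds the deviation of the output from the maximally
mixed state. -/
noncomputable def chainNorm {L : ℕ} (W : Fin L → Weight n) : ℝ :=
  Fin.foldl L (fun g j => normOneOne (W j) * (1 + g)) 0

theorem chainNorm_succ {L : ℕ} (W : Fin (L + 1) → Weight n) :
    chainNorm W = normOneOne (W (Fin.last L)) * (1 + chainNorm fun j => W j.castSucc) := by
  rw [chainNorm, Fin.foldl_succ_last]
  rfl

theorem chainNorm_nonneg {L : ℕ} (W : Fin L → Weight n) : 0 ≤ chainNorm W := by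
  induction L with
  | zero => simp [chainNorm]
  | succ L ih =>
    rw [chainNorm_succ]
    exact mul_nonneg (normOneOne_nonneg _) (by linarith [ih fun j => W j.castSucc])

theorem betaPM_succ {L : ℕ} (W : Fin (L + 1) → Weight n) :
    betaPM W = normOneOne (W (Fin.last L)) * betaPM (fun j => W j.castSucc) + 1 := by
  rw [betaPM, Fin.sum_univ_castSucc, betaPM, Finset.mul_sum]
  congr 1
  · refine Finset.sum_congr rfl fun j _ => ?_
    rw [Finset.prod_filter, Fin.prod_univ_castSucc, Finset.prod_filter, mul_comm]
    simp [Fin.castSucc_lt_last]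
  · rw [Finset.prod_filter]
    refine Finset.prod_eq_one fun l _ => ?_
    rw [if_neg (not_lt.2 (Fin.le_last l))]

/-- Each summand of `chainNorm` is the corresponding summand of `betaPM` with the one extra factor
`normOneOne (W j)`. -/
theorem chainNorm_le_mul_betaPM {L : ℕ} (W : Fin L → Weight n) {m : ℝ}
    (h : ∀ j, normOneOne (W j) ≤ m) : chainNorm W ≤ m * betaPM W := by
  induction L with
  | zero => simp [chainNorm, betaPM]
  | succ L ih =>
    rw [chainNorm_succ, betaPM_succ]
    have h1 := mul_le_mul_of_nonneg_left (ih (fun j => W j.castSucc) fun j => h _)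
      (normOneOne_nonneg (W (Fin.last L)))
    linarith [h (Fin.last L)]

/-- The bound 2m is preserved by g ↦ m(1 + g), because 2m ≤ 1. -/
theorem chainNorm_le_two_mul {L : ℕ} (W : Fin L → Weight n) {m : ℝ} (hm0 : 0 ≤ m)
    (hm : m ≤ 1 / 2) (h : ∀ j, normOneOne (W j) ≤ m) : chainNorm W ≤ 2 * m := by
  induction L with
  | zero => simpa [chainNorm] using hm0
  | succ L ih =>
    rw [chainNorm_succ]
    have h1 := ih (fun j => W j.castSucc) fun j => h _
    have h2 := mul_le_mul (h (Fin.last L)) (add_le_add_right h1 1)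
      (by linarith [chainNorm_nonneg fun j : Fin L => W j.castSucc]) hm0
    nlinarith

/-! ### States produced by admissible models. -/

theorem outputState_succ {L : ℕ} (W : Fin (L + 1) → Weight n) (τ : Op n) :
    outputState W τ = layer (W (Fin.last L)) (outputState (fun j => W j.castSucc) τ) := by
  rw [outputState, Fin.foldl_succ_last]
  rfl

theorem outputState_zero (W : Fin 0 → Weight n) (τ : Op n) : outputState W τ = τ := rfl

theorem layer_isDensity {W : Weight n} (h : IsQuantumChannel (layer W)) {τ : Op n}
    (hτ : IsDensity τ) : IsDensity (layer W τ) := by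
  refine ⟨?_, (h.tracePreserving τ).trans hτ.trace_eq_one⟩
  -- Complete positivity with a one-dimensional ancilla is positivity of the layer.
  have h1 := h.completelyPositive 1 _ (hτ.posSemidef.submatrix fun p : Fin 1 × Basis n => p.2)
  exact h1.submatrix fun a : Basis n => ((0 : Fin 1), a)

theorem outputState_isDensity {L : ℕ} {W : Fin L → Weight n}
    (h : ∀ j, IsQuantumChannel (layer (W j))) {τ : Op n} (hτ : IsDensity τ) :
    IsDensity (outputState W τ) := by
  induction L with
  | zero => exact hτ
  | succ L ih =>
    rw [outputState_succ]
    exact layer_isDensity (h _) (ih fun j => h j.castSucc)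

theorem maxMixed_isDensity : IsDensity (maxMixed n) where
  posSemidef := Matrix.PosSemidef.one.smul (by positivity)
  trace_eq_one := by
    rw [maxMixed, Matrix.trace_smul, trace_one_op, smul_eq_mul]
    field_simp

theorem modelOutput_eq {L : ℕ} (W : Fin L → Weight n) (τ : Op n) (k : Basis n) :
    modelOutput W τ k = (outputState W τ k k).re := by
  rw [modelOutput, Matrix.trace_mul_comm]
  congr 1
  rw [Matrix.trace, Finset.sum_eq_single k]
  · simp
  · intro b _ hb
    rw [Matrix.diag_apply, Matrix.mul_single_apply_of_ne _ _ _ _ _ hb]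
  · simp

theorem isDensity_diag_mem_Icc {τ : Op n} (hτ : IsDensity τ) (k : Basis n) :
    (τ k k).re ∈ Set.Icc (0 : ℝ) 1 := by
  refine ⟨(posSemidef_diag_real hτ.posSemidef k).2, ?_⟩
  have h := congrArg Complex.re hτ.trace_eq_one
  simp only [Matrix.trace, Matrix.diag_apply, Complex.re_sum, Complex.one_re] at h
  rw [← h]
  exact Finset.single_le_sum (f := fun k => (τ k k).re)
    (fun i _ => (posSemidef_diag_real hτ.posSemidef i).2) (Finset.mem_univ k)

theorem sum_norm_sq_eq_trace (M : Op n) :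
    ((∑ k, ∑ l, ‖M k l‖ ^ 2 : ℝ) : ℂ) = (M * M.conjTranspose).trace := by
  simp only [Matrix.trace, Matrix.diag_apply, Matrix.mul_apply, Matrix.conjTranspose_apply]
  push_cast
  refine Finset.sum_congr rfl fun k _ => Finset.sum_congr rfl fun l _ => ?_
  rw [Complex.star_def, Complex.mul_conj, Complex.normSq_eq_norm_sq]
  push_cast
  rfl

/-- Pauli strings are unitary, so the Frobenius norm of the word is that of τ, and the 2×2 minors
bound its square by (Tr τ)² = 1. This is what keeps the number of classes out of the final bound. -/
theorem sum_norm_diag_sq_le_one {τ : Op n} (hτ : IsDensity τ) (A B : PauliIdx n) :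
    ∑ k, ‖(pauli A * τ * pauli B) k k‖ ^ 2 ≤ 1 := by
  have h1 : ∑ k, ∑ l, ‖(pauli A * τ * pauli B) k l‖ ^ 2 = ∑ k, ∑ l, ‖τ k l‖ ^ 2 := by
    have := sum_norm_sq_eq_trace (pauli A * τ * pauli B)
    rw [Matrix.conjTranspose_mul, Matrix.conjTranspose_mul, pauli_conjTranspose,
      pauli_conjTranspose, show pauli A * τ * pauli B * (pauli B * (τ.conjTranspose * pauli A)) =
        pauli A * τ * (pauli B * pauli B) * τ.conjTranspose * pauli A by
          simp only [Matrix.mul_assoc], pauli_mul_self, Matrix.trace_mul_comm,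
      show pauli A * (pauli A * τ * 1 * τ.conjTranspose) = (pauli A * pauli A) * (τ *
        τ.conjTranspose) by simp only [Matrix.mul_assoc, Matrix.one_mul], pauli_mul_self,
      Matrix.one_mul, ← sum_norm_sq_eq_trace] at this
    exact_mod_cast this
  have htr : ∑ k, (τ k k).re = 1 := by
    have h := congrArg Complex.re hτ.trace_eq_one
    simpa only [Matrix.trace, Matrix.diag_apply, Complex.re_sum, Complex.one_re] using h
  calc _ ≤ ∑ k, ∑ l, ‖(pauli A * τ * pauli B) k l‖ ^ 2 := Finset.sum_le_sum fun k _ =>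
        Finset.single_le_sum (f := fun l => ‖(pauli A * τ * pauli B) k l‖ ^ 2)
          (fun _ _ => sq_nonneg _) (Finset.mem_univ k)
    _ = ∑ k, ∑ l, ‖τ k l‖ ^ 2 := h1
    _ ≤ ∑ k, ∑ l, (τ k k).re * (τ l l).re := Finset.sum_le_sum fun k _ =>
        Finset.sum_le_sum fun l _ => posSemidef_norm_sq_le hτ.posSemidef k l
    _ = 1 := by simp only [← Finset.mul_sum, htr, mul_one]

/-! ### Linear functionals of outputs, expanded in Pauli words. -/

section Functional

variable {I : Type*} (f : (I → Op n) →ₗ[ℂ] ℂ)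

/-- Sandwiching a word between Pauli strings gives another word up to a unit phase, so Q bounds
every term of the expansion. -/
theorem norm_functional_weightMap_le (W : Weight n) (τ : I → Op n) {Q : ℝ}
    (hQ : ∀ A B, ‖f fun i => pauli A * τ i * pauli B‖ ≤ Q) (A B : PauliIdx n) :
    ‖f fun i => pauli A * weightMap W (τ i) * pauli B‖ ≤ normOneOne W * Q := by
  have e : (fun i => pauli A * weightMap W (τ i) * pauli B) =
      ∑ A', ∑ B', W A' B' • fun i => pauli A * (pauli A' * τ i * pauli B') * pauli B := by
    ext1 i
    simp only [weightMap, Matrix.mul_sum, Matrix.sum_mul, Matrix.mul_smul, Matrix.smul_mul,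
      Finset.sum_apply, Pi.smul_apply]
  rw [e]
  simp only [map_sum, map_smul, normOneOne, Finset.sum_mul]
  refine (norm_sum_le _ _).trans (Finset.sum_le_sum fun A' _ => ?_)
  refine (norm_sum_le _ _).trans (Finset.sum_le_sum fun B' _ => ?_)
  rw [norm_smul]
  refine mul_le_mul_of_nonneg_left ?_ (norm_nonneg _)
  obtain ⟨C, z, hz, hC⟩ := pauli_mul A A'
  obtain ⟨C', z', hz', hC'⟩ := pauli_mul B' B
  have : (fun i => pauli A * (pauli A' * τ i * pauli B') * pauli B) =
      (z * z') • fun i => pauli C * τ i * pauli C' := by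
    ext1 i
    rw [show pauli A * (pauli A' * τ i * pauli B') * pauli B =
      (pauli A * pauli A') * τ i * (pauli B' * pauli B) by simp only [Matrix.mul_assoc], hC, hC']
    simp [smul_smul, mul_comm]
  rw [this, map_smul, norm_smul, norm_mul, hz, hz', one_mul, one_mul]
  exact hQ C C'

/-- Every layer contributes a fresh maximally mixed term, intermediate states having trace one, plus
`normOneOne` times the preceding bound. This is the recursion of `1 + chainNorm`. -/
theorem norm_functional_outputState_le {L : ℕ} {W : Fin L → Weight n}
    (h : ∀ j, IsQuantumChannel (layer (W j))) {τ : I → Op n} (hτ : ∀ i, IsDensity (τ i)) {Q : ℝ}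
    (hQ : ∀ A B, ‖f fun i => pauli A * τ i * pauli B‖ ≤ Q)
    (hQ' : ∀ A B, ‖f fun _ => pauli A * maxMixed n * pauli B‖ ≤ Q) (A B : PauliIdx n) :
    ‖f fun i => pauli A * outputState W (τ i) * pauli B‖ ≤ (1 + chainNorm W) * Q := by
  induction L generalizing A B with
  | zero => simpa [chainNorm, outputState_zero] using hQ A B
  | succ L ih =>
    have h1 := norm_functional_weightMap_le f (W (Fin.last L)) _ (ih fun j => h j.castSucc) A B
    have e : (fun i => pauli A * outputState W (τ i) * pauli B) =
        (fun _ => pauli A * maxMixed n * pauli B) + fun i => pauli A * weightMap (W (Fin.last L))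
          (outputState (fun j => W j.castSucc) (τ i)) * pauli B := by
      ext1 i
      rw [outputState_succ, layer_eq,
        (outputState_isDensity (fun j : Fin L => h j.castSucc) (hτ i)).trace_eq_one, one_smul,
        Pi.add_apply, mul_add, add_mul]
    rw [e, map_add, chainNorm_succ]
    refine (norm_add_le _ _).trans ((add_le_add (hQ' A B) h1).trans (le_of_eq ?_))
    ring

/-- Subtracting the maximally mixed state cancels the fresh term of the last layer, improving `1 +
chainNorm W` to `chainNorm W`; this needs at least one layer. -/
theorem norm_functional_sub_le {L : ℕ} (hL : 1 ≤ L) {W : Fin L → Weight n}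
    (h : ∀ j, IsQuantumChannel (layer (W j))) {τ : I → Op n} (hτ : ∀ i, IsDensity (τ i)) {Q : ℝ}
    (hQ : ∀ A B, ‖f fun i => pauli A * τ i * pauli B‖ ≤ Q)
    (hQ' : ∀ A B, ‖f fun _ => pauli A * maxMixed n * pauli B‖ ≤ Q) :
    ‖f fun i => outputState W (τ i) - maxMixed n‖ ≤ chainNorm W * Q := by
  obtain ⟨L, rfl⟩ : ∃ l, L = l + 1 := ⟨L - 1, by omega⟩
  have h1 := norm_functional_weightMap_le f (W (Fin.last L)) _
    (norm_functional_outputState_le f (fun j : Fin L => h j.castSucc) hτ hQ hQ') 0 0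
  rw [chainNorm_succ, mul_assoc]
  convert h1 using 4 with i
  rw [outputState_succ, layer_eq,
    (outputState_isDensity (fun j : Fin L => h j.castSucc) (hτ i)).trace_eq_one, one_smul,
    pauli_zero, Matrix.one_mul, Matrix.mul_one, add_sub_cancel_left]

end Functional

/-! ### Sparsity, norms and size of the entries of a weight. -/

theorem normOneOne_sq_le (W : Weight n) : normOneOne W ^ 2 ≤ sparsity W * frobSq W := by
  classical
  have e : ∀ (g : ℂ → ℝ), g 0 = 0 → ∑ A, ∑ B, g (W A B) =
      ∑ p ∈ Finset.univ.filter (fun p : PauliIdx n × PauliIdx n => W p.1 p.2 ≠ 0),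
        g (W p.1 p.2) := fun g hg => by
    rw [Finset.sum_filter, Fintype.sum_prod_type]
    refine Finset.sum_congr rfl fun A _ => Finset.sum_congr rfl fun B _ => ?_
    by_cases h : W A B = 0 <;> simp [h, hg]
  have h := sq_sum_le_card_mul_sum_sq
    (s := Finset.univ.filter (fun p : PauliIdx n × PauliIdx n => W p.1 p.2 ≠ 0))
    (f := fun p => ‖W p.1 p.2‖)
  rw [normOneOne, frobSq, e (fun z => ‖z‖) (by simp), e (fun z => ‖z‖ ^ 2) (by simp), sparsity]
  convert h

theorem normOneOne_le_sparsity_mul {W : Weight n} {m : ℝ} (h : ∀ A B, ‖W A B‖ ≤ m) :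
    normOneOne W ≤ sparsity W * m := by
  classical
  have e : normOneOne W =
      ∑ p ∈ Finset.univ.filter (fun p : PauliIdx n × PauliIdx n => W p.1 p.2 ≠ 0),
        ‖W p.1 p.2‖ := by
    rw [normOneOne, Finset.sum_filter, Fintype.sum_prod_type]
    refine Finset.sum_congr rfl fun A _ => Finset.sum_congr rfl fun B _ => ?_
    by_cases h : W A B = 0 <;> simp [h]
  rw [e, sparsity, ← nsmul_eq_mul]
  refine (Finset.sum_le_card_nsmul (Finset.univ.filter
    fun p : PauliIdx n × PauliIdx n => W p.1 p.2 ≠ 0) (fun p => ‖W p.1 p.2‖) m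
    fun p _ => h p.1 p.2).trans (le_of_eq ?_)
  congr

/-- The diagonal of χ is nonnegative with sum 1, so the diagonal entries of W are at least -1/4^n
and sum to zero. A positive one is compensated by at most ξ negative ones, whence χ(A,A) ≤
(ξ+1)/4^n. Off the diagonal W equals χ, and the 2×2 minors apply. -/
theorem norm_weight_le {W : Weight n} (h : IsQuantumChannel (layer W)) (A B : PauliIdx n) :
    ‖W A B‖ ≤ (sparsity W + 1) / 4 ^ n := by
  classical
  have hp := processMatrix_posSemidef W h
  have hχ : ∀ A, (processMatrix W A A).re = 1 / 4 ^ n + (W A A).re := fun A => by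
    simp only [processMatrix, Matrix.of_apply, if_true, Complex.add_re]
    congr 1
    have : (1 : ℂ) / 4 ^ n = ((1 / 4 ^ n : ℝ) : ℂ) := by push_cast; rfl
    rw [this, Complex.ofReal_re]
  have hχ0 : ∀ A, 0 ≤ (processMatrix W A A).re := fun A => (posSemidef_diag_real hp A).2
  have hlow : ∀ A, -(1 / 4 ^ n) ≤ (W A A).re := fun A => by linarith [hχ0 A, hχ A]
  have hsum : ∑ A, (W A A).re = 0 := by
    have h1 := congrArg Complex.re (sum_processMatrix_diag W h)
    simp only [Complex.re_sum, hχ, Finset.sum_add_distrib, Complex.one_re] at h1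
    have : ∑ _A : PauliIdx n, (1 : ℝ) / 4 ^ n = 1 := by
      simp
    linarith
  have hcard : ((Finset.univ.filter fun A : PauliIdx n => W A A ≠ 0).card : ℝ) ≤ sparsity W := by
    rw [sparsity]
    norm_cast
    refine Finset.card_le_card_of_injOn (fun A => (A, A)) (fun A hA => ?_) fun A _ B _ hAB =>
      (Prod.mk.inj hAB).1
    simpa using hA
  have hup : ∀ A, (W A A).re ≤ sparsity W / 4 ^ n := fun A => by
    have h1 : (W A A).re = ∑ B ∈ Finset.univ.erase A, -(W B B).re := by
      rw [Finset.sum_neg_distrib]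
      have := Finset.add_sum_erase Finset.univ (fun A => (W A A).re) (Finset.mem_univ A)
      linarith
    rw [h1]
    calc _ ≤ ∑ B ∈ Finset.univ.erase A, if W B B ≠ 0 then (1 : ℝ) / 4 ^ n else 0 := by
          refine Finset.sum_le_sum fun B _ => ?_
          split_ifs with hB
          · linarith [hlow B]
          · rw [not_not.1 hB]; simp
      _ ≤ ∑ B, if W B B ≠ 0 then (1 : ℝ) / 4 ^ n else 0 :=
          Finset.sum_le_sum_of_subset_of_nonneg (Finset.subset_univ _) fun B _ _ => by
            split_ifs <;> positivity
      _ = ((Finset.univ.filter fun A : PauliIdx n => W A A ≠ 0).card : ℝ) * (1 / 4 ^ n) := by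
          rw [← Finset.sum_filter, Finset.sum_const, nsmul_eq_mul]
      _ ≤ sparsity W * (1 / 4 ^ n) := mul_le_mul_of_nonneg_right hcard (by positivity)
      _ = _ := by ring
  have hχup : ∀ A, (processMatrix W A A).re ≤ (sparsity W + 1) / 4 ^ n := fun A => by
    rw [hχ, add_div, add_comm]
    linarith [hup A]
  have hpos : (0 : ℝ) ≤ sparsity W / 4 ^ n := by positivity
  by_cases hAB : A = B
  · subst hAB
    have hr : ‖W A A‖ = |(W A A).re| := by
      have h1 := (posSemidef_diag_real hp A).1
      have h2 : W A A = (((W A A).re : ℝ) : ℂ) := by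
        rw [hχ] at h1
        simp only [processMatrix, Matrix.of_apply, if_true] at h1
        push_cast at h1
        exact add_left_cancel h1
      conv_lhs => rw [h2]
      rw [Complex.norm_real, Real.norm_eq_abs]
    rw [hr, add_div, abs_le]
    have : (0 : ℝ) < 1 / 4 ^ n := by positivity
    constructor
    · linarith [hlow A]
    · linarith [hup A]
  · have h1 := posSemidef_norm_sq_le hp A B
    have h2 : processMatrix W A B = W A B := by simp [processMatrix, hAB]
    rw [h2] at h1
    refine le_of_sq_le_sq ?_ (by positivity)
    refine h1.trans ?_
    rw [sq]
    exact mul_le_mul (hχup A) (hχup B) (hχ0 B) (by positivity)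

end PMModel

/-! ### The ramp loss and its uniform deviations -/

namespace PMModel

open SignAverage

variable {n : ℕ}

/-! ### The ramp loss. -/

/-- The multiclass ramp loss at scale `γ`, which interpolates between the two margin losses. -/
noncomputable def rampLoss (γ : ℝ) (f : Basis n → ℝ) (y : Basis n) : ℝ :=
  Finset.univ.sup' Finset.univ_nonempty fun k =>
    if k = y then 0 else max 0 (min 1 (1 + (f k - f y) / γ))

theorem rampLoss_mem_Icc (γ : ℝ) (f : Basis n → ℝ) (y : Basis n) :
    rampLoss γ f y ∈ Set.Icc (0 : ℝ) 1 := by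
  constructor
  · refine Finset.le_sup'_of_le _ (Finset.mem_univ y) ?_
    simp
  · refine Finset.sup'_le _ _ fun k _ => ?_
    split_ifs <;> simp

theorem one_le_rampLoss {γ : ℝ} (hγ : 0 < γ) {f : Basis n → ℝ} {y : Basis n}
    (h : MarginError 0 f y) : 1 ≤ rampLoss γ f y := by
  obtain ⟨k, hk, hf⟩ := h
  refine Finset.le_sup'_of_le _ (Finset.mem_univ k) ?_
  rw [if_neg hk]
  have : 0 ≤ (f k - f y) / γ := div_nonneg (by linarith) hγ.le
  rw [min_eq_left (by linarith)]
  exact le_max_right _ _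

theorem rampLoss_le_zero {γ : ℝ} (hγ : 0 < γ) {f : Basis n → ℝ} {y : Basis n}
    (h : ¬ MarginError γ f y) : rampLoss γ f y ≤ 0 := by
  refine Finset.sup'_le _ _ fun k _ => ?_
  split_ifs with hk
  · exact le_rfl
  · have h1 : γ + f k < f y := not_le.1 fun h' => h ⟨k, hk, h'⟩
    have h2 : (f k - f y) / γ ≤ -1 := by
      rw [div_le_iff₀ hγ]
      linarith
    refine max_le le_rfl ((min_le_right _ _).trans ?_)
    linarith

theorem rampLoss_sub_le {γ : ℝ} (hγ : 0 < γ) (f g : Basis n → ℝ) (y : Basis n) :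
    rampLoss γ f y - rampLoss γ g y ≤ √(∑ k, (2 / γ * f k - 2 / γ * g k) ^ 2) := by
  set R := √(∑ k, (2 / γ * f k - 2 / γ * g k) ^ 2) with hR
  -- A difference f k - f y involves two coordinates, each moving by at most γR/2; hence the factor
  -- 2/γ in R.
  have hk : ∀ k, |f k - g k| / γ ≤ R / 2 := fun k => by
    have h1 : |2 / γ * f k - 2 / γ * g k| ≤ R := by
      rw [hR, ← Real.sqrt_sq_eq_abs]
      exact Real.sqrt_le_sqrt (Finset.single_le_sum
        (f := fun k => (2 / γ * f k - 2 / γ * g k) ^ 2) (fun _ _ => sq_nonneg _)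
        (Finset.mem_univ k))
    rw [← mul_sub, abs_mul, abs_of_pos (by positivity : 0 < 2 / γ)] at h1
    rw [div_mul_eq_mul_div, mul_div_assoc] at h1
    linarith
  rw [sub_le_iff_le_add]
  refine Finset.sup'_le _ _ fun k _ => ?_
  have hg := Finset.le_sup' (fun k => if k = y then 0 else max 0 (min 1 (1 + (g k - g y) / γ)))
    (Finset.mem_univ k)
  refine le_trans ?_ (add_le_add_right hg R)
  have hR0 : 0 ≤ R := Real.sqrt_nonneg _
  split_ifs with h
  · linarith
  · have h1 : (f k - f y) / γ ≤ (g k - g y) / γ + R := by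
      have a := (le_abs_self (f k - g k)).trans (div_le_iff₀ hγ |>.1 (hk k))
      have b := (neg_abs_le (f y - g y)).trans' (neg_le_neg (div_le_iff₀ hγ |>.1 (hk y)))
      rw [div_le_iff₀ hγ, add_mul, div_mul_cancel₀ _ hγ.ne']
      linarith
    refine max_le (by linarith [le_max_left 0 (min 1 (1 + (g k - g y) / γ))]) ?_
    have h2 : min 1 (1 + (f k - f y) / γ) ≤ R + min 1 (1 + (g k - g y) / γ) := by
      rcases min_cases 1 (1 + (g k - g y) / γ) with h | h
      · rw [h.1]; linarith [min_le_left 1 (1 + (f k - f y) / γ)]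
      · rw [h.1]; linarith [min_le_right 1 (1 + (f k - f y) / γ)]
    linarith [le_max_right 0 (min 1 (1 + (g k - g y) / γ))]

theorem abs_rampLoss_sub_le {γ : ℝ} (hγ : 0 < γ) (f g : Basis n → ℝ) (y : Basis n) :
    |rampLoss γ f y - rampLoss γ g y| ≤ √(∑ k, (2 / γ * f k - 2 / γ * g k) ^ 2) := by
  rw [abs_le]
  refine ⟨?_, rampLoss_sub_le hγ f g y⟩
  have := rampLoss_sub_le hγ g f y
  simp only [fun k => (by ring : (2 / γ * g k - 2 / γ * f k) ^ 2 =
    (2 / γ * f k - 2 / γ * g k) ^ 2)] at this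
  linarith

theorem continuous_rampLoss {T : Type*} [TopologicalSpace T] (γ : ℝ) (y : Basis n)
    {f : T → Basis n → ℝ} (hf : ∀ k, Continuous fun w => f w k) :
    Continuous fun w => rampLoss γ (f w) y := by
  refine Continuous.finset_sup'_apply _ fun k _ => ?_
  by_cases h : k = y
  · simpa [h] using continuous_const
  · simp only [h, if_false]
    exact continuous_const.max (continuous_const.min
      (continuous_const.add (((hf k).sub (hf y)).div_const γ)))

theorem measurable_rampLoss {X : Type*} [MeasurableSpace X] (γ : ℝ) {f : X → Basis n → ℝ}
    (hf : ∀ k, Measurable fun x => f x k) :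
    Measurable fun z : X × Basis n => rampLoss γ (f z.1) z.2 := by
  refine measurable_from_prod_countable_left fun y => ?_
  have : (fun x => rampLoss γ (f x) y) = fun x => ⨆ k,
      if k = y then 0 else max 0 (min 1 (1 + (f x k - f x y) / γ)) := by
    funext x
    rw [rampLoss, Finset.sup'_univ_eq_ciSup]
  simp only [this]
  refine Measurable.iSup fun k => ?_
  by_cases h : k = y
  · simp [h]
  · simp only [h, if_false]
    exact measurable_const.max (measurable_const.min
      (measurable_const.add (((hf k).sub (hf y)).div_const γ)))

/-! ### Continuity in the weights and measurability in the data. -/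

theorem layer_apply (W : Weight n) (Y : Op n) (a b : Basis n) :
    layer W Y a b = ∑ A, ∑ B, processMatrix W A B *
      ∑ d, (∑ c, pauli A a c * Y c d) * pauli B d b := by
  have : layer W Y = ∑ A, ∑ B, processMatrix W A B • (pauli A * Y * pauli B) := rfl
  rw [this]
  simp only [Matrix.sum_apply, Matrix.smul_apply, Matrix.mul_apply, smul_eq_mul]

theorem continuous_outputState {L : ℕ} (τ : Op n) (a b : Basis n) :
    Continuous fun W : Fin L → Weight n => outputState W τ a b := by
  induction L generalizing a b with
  | zero => exact continuous_const
  | succ L ih =>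
    simp only [outputState_succ, layer_apply, processMatrix, Matrix.of_apply]
    have h1 : ∀ c d, Continuous fun W : Fin (L + 1) → Weight n =>
        outputState (fun j : Fin L => W j.castSucc) τ c d := fun c d =>
      (ih c d).comp (continuous_pi fun j => continuous_apply j.castSucc)
    refine continuous_finsetSum _ fun A _ => continuous_finsetSum _ fun B _ => ?_
    refine Continuous.mul (continuous_const.add ?_) ?_
    · exact (continuous_apply B).comp ((continuous_apply A).comp (continuous_apply (Fin.last L)))
    · exact continuous_finsetSum _ fun d _ => (continuous_finsetSum _ fun c _ =>
        continuous_const.mul (h1 c d)).mul continuous_const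

theorem continuous_modelOutput {L : ℕ} (τ : Op n) (k : Basis n) :
    Continuous fun W : Fin L → Weight n => modelOutput W τ k := by
  simp only [modelOutput_eq]
  exact Complex.continuous_re.comp (continuous_outputState τ k k)

theorem measurable_outputState {X : Type*} [MeasurableSpace X] {ρ : X → Op n}
    (hρ : ∀ a b, Measurable fun x => ρ x a b) {L : ℕ} (W : Fin L → Weight n) (a b : Basis n) :
    Measurable fun x => outputState W (ρ x) a b := by
  induction L generalizing a b with
  | zero => exact hρ a b
  | succ L ih =>
    simp only [outputState_succ, layer_apply]
    refine Finset.measurable_sum _ fun A _ => Finset.measurable_sum _ fun B _ => ?_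
    refine Measurable.const_mul (Finset.measurable_sum _ fun d _ => ?_) _
    exact (Finset.measurable_sum _ fun c _ =>
      (ih (fun j => W j.castSucc) c d).const_mul _).mul_const _

theorem measurable_modelOutput {X : Type*} [MeasurableSpace X] {ρ : X → Op n}
    (hρ : ∀ a b, Measurable fun x => ρ x a b) {L : ℕ} (W : Fin L → Weight n) (k : Basis n) :
    Measurable fun x => modelOutput W (ρ x) k := by
  simp only [modelOutput_eq]
  exact Complex.measurable_re.comp (measurable_outputState hρ W k k)

/-! ### Rademacher averages of the models. -/

/-- The functional `(τ_i) ↦ ∑_i ∑_k c_{ik} ⟨k|τ_i|k⟩`. -/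
noncomputable def diagFunctional {I : Type*} [Fintype I] (c : I → Basis n → ℝ) :
    (I → Op n) →ₗ[ℂ] ℂ where
  toFun τ := ∑ i, ∑ k, (c i k : ℂ) * τ i k k
  map_add' τ τ' := by
    simp only [Pi.add_apply, Matrix.add_apply, mul_add, Finset.sum_add_distrib]
  map_smul' z τ := by
    simp only [Pi.smul_apply, Matrix.smul_apply, smul_eq_mul, RingHom.id_apply, Finset.mul_sum]
    exact Finset.sum_congr rfl fun i _ => Finset.sum_congr rfl fun k _ => by ring

theorem diagFunctional_apply {I : Type*} [Fintype I] (c : I → Basis n → ℝ) (τ : I → Op n) :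
    diagFunctional c τ = ∑ i, ∑ k, (c i k : ℂ) * τ i k k := rfl

theorem maxMixed_diag_re (k : Basis n) : (maxMixed n k k).re = 1 / 2 ^ n := by
  have : maxMixed n k k = ((1 / 2 ^ n : ℝ) : ℂ) := by
    rw [maxMixed, Matrix.smul_apply, Matrix.one_apply_eq, smul_eq_mul, mul_one]
    push_cast
    rfl
  rw [this, Complex.ofReal_re]

theorem norm_pauli_conj_diag_le_one {τ : Op n} (hτ : IsDensity τ) (A B : PauliIdx n)
    (k : Basis n) : ‖(pauli A * τ * pauli B) k k‖ ≤ 1 := by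
  have h := (Finset.single_le_sum (f := fun k => ‖(pauli A * τ * pauli B) k k‖ ^ 2)
    (fun _ _ => sq_nonneg _) (Finset.mem_univ k)).trans (sum_norm_diag_sq_le_one hτ A B)
  exact (sq_le_one_iff₀ (norm_nonneg _)).1 h

theorem abs_modelOutput_sub_le {L : ℕ} (hL : 1 ≤ L) {W : Fin L → Weight n}
    (h : ∀ j, IsQuantumChannel (layer (W j))) {τ : Op n} (hτ : IsDensity τ) (k : Basis n) :
    |modelOutput W τ k - 1 / 2 ^ n| ≤ chainNorm W := by
  set c : Unit → Basis n → ℝ := fun _ => Pi.single k 1 with hc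
  have he : ∀ σ : Unit → Op n, diagFunctional c σ = σ () k k := fun σ => by
    rw [diagFunctional_apply, Fintype.sum_unique, Finset.sum_eq_single k]
    · simp [hc]
    · intro b _ hb
      simp [hc, hb]
    · simp
  have h1 := norm_functional_sub_le (diagFunctional c) hL h (τ := fun _ => τ) (fun _ => hτ) (Q := 1)
    (fun A B => by rw [he]; exact norm_pauli_conj_diag_le_one hτ A B k)
    (fun A B => by rw [he]; exact norm_pauli_conj_diag_le_one maxMixed_isDensity A B k)
  rw [he, mul_one] at h1
  refine le_trans ?_ h1
  rw [modelOutput_eq, ← maxMixed_diag_re k, ← Complex.sub_re]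
  exact Complex.abs_re_le_norm _

/-- The Rademacher average of the ramp losses of the models with `chainNorm W ≤ g`. -/
theorem expect_iSup_rampLoss_le {L N : ℕ} (hn : 1 ≤ n) (hL : 1 ≤ L) (hN : 1 ≤ N) {γ g : ℝ}
    (hγ : 0 < γ) (hg : 0 ≤ g) {ι : Type*} [Finite ι] [Nonempty ι] (W : ι → Fin L → Weight n)
    (hW : ∀ a j, IsQuantumChannel (layer (W a j))) (hWg : ∀ a, chainNorm (W a) ≤ g)
    {τ : Fin N → Op n} (hτ : ∀ i, IsDensity (τ i)) (y : Fin N → Basis n) :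
    𝔼 ε : Fin N → ℤˣ, ⨆ a, ∑ i, ((ε i : ℤ) : ℝ) * rampLoss γ (modelOutput (W a) (τ i)) (y i) ≤
      32 * (g / γ) * √(n * N) := by
  have hN0 : (0 : ℝ) < N := by exact_mod_cast hN
  have hn1 : (1 : ℝ) ≤ n := by exact_mod_cast hn
  -- Centring at 1/2^n leaves differences unchanged and exposes the deviation from the maximally
  -- mixed state.
  have h1 := expect_contraction
    (fun (i : Fin N) a => rampLoss γ (modelOutput (W a) (τ i)) (y i))
    (fun i a k => 2 / γ * (modelOutput (W a) (τ i) k - 1 / 2 ^ n)) (fun _ => 0)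
    (fun i a b => by
      refine (abs_rampLoss_sub_le hγ _ _ _).trans (le_of_eq ?_)
      congr 1
      exact Finset.sum_congr rfl fun k _ => by ring)
  simp only [add_zero] at h1
  refine h1.trans ?_
  -- A finite index set independent of the weights: input or maximally mixed state, real or
  -- imaginary part, and the two Pauli strings of a word.
  set M := Bool × Bool × PauliIdx n × PauliIdx n with hM
  set G : M → Fin N × Basis n → ℝ := fun m p =>
    let z := (pauli m.2.2.1 * (if m.1 then τ p.1 else maxMixed n) * pauli m.2.2.2) p.2 p.2
    if m.2.1 then z.re else z.im with hG
  have hGV : ∀ m, ∑ p, G m p ^ 2 ≤ N := by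
    rintro ⟨b, b', A, B⟩
    rw [Fintype.sum_prod_type]
    have : ∀ i, ∑ k, G ⟨b, b', A, B⟩ (i, k) ^ 2 ≤ 1 := fun i => by
      have hd : IsDensity (if b then τ i else maxMixed n) := by
        split_ifs
        · exact hτ i
        · exact maxMixed_isDensity
      refine le_trans (Finset.sum_le_sum fun k _ => ?_) (sum_norm_diag_sq_le_one hd A B)
      simp only [hG]
      rw [← sq_abs]
      refine pow_le_pow_left₀ (abs_nonneg _) ?_ 2
      by_cases h : b' = true
      · rw [if_pos h]; exact Complex.abs_re_le_norm _
      · rw [if_neg h]; exact Complex.abs_im_le_norm _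
    refine (Finset.sum_le_sum fun i _ => this i).trans (by simp)
  set E : (Fin N → Basis n → ℤˣ) → ℝ := fun κ => ⨆ m, |∑ p, ((κ p.1 p.2 : ℤ) : ℝ) * G m p| with hE
  have hE1 : 𝔼 κ, E κ ≤ √(2 * N * Real.log (2 * Fintype.card M)) := by
    rw [← Fintype.expect_equiv (Equiv.curry (Fin N) (Basis n) ℤˣ)
      (fun κ => ⨆ m, |∑ p, ((κ p : ℤ) : ℝ) * G m p|) E fun κ => rfl]
    exact expect_iSup_abs_le G hN0 hGV
  -- The constant 8 is 2 from contraction, 2 from the Lipschitz constant 2/γ, and 2 for real and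
  -- imaginary parts.
  have hpt : ∀ κ : Fin N → Basis n → ℤˣ, ⨆ a, ∑ i, 2 * ∑ k, ((κ i k : ℤ) : ℝ) *
      (2 / γ * (modelOutput (W a) (τ i) k - 1 / 2 ^ n)) ≤ 8 * (g / γ) * E κ := by
    intro κ
    refine ciSup_le fun a => ?_
    set c : Fin N → Basis n → ℝ := fun i k => ((κ i k : ℤ) : ℝ) with hc
    have hre : ∀ σ : Fin N → Op n, (diagFunctional c σ).re = ∑ i, ∑ k, c i k * (σ i k k).re :=
      fun σ => by
        rw [diagFunctional_apply]
        simp only [Complex.re_sum, Complex.re_ofReal_mul]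
    have him : ∀ σ : Fin N → Op n, (diagFunctional c σ).im = ∑ i, ∑ k, c i k * (σ i k k).im :=
      fun σ => by
        rw [diagFunctional_apply]
        simp only [Complex.im_sum, Complex.im_ofReal_mul]
    have hQ : ∀ (b : Bool) A B, ‖diagFunctional c fun i =>
        pauli A * (if b then τ i else maxMixed n) * pauli B‖ ≤ 2 * E κ := fun b A B => by
      refine (Complex.norm_le_abs_re_add_abs_im _).trans ?_
      have e1 := le_iSup_finite (fun m => |∑ p, ((κ p.1 p.2 : ℤ) : ℝ) * G m p|) (b, true, A, B)
      have e2 := le_iSup_finite (fun m => |∑ p, ((κ p.1 p.2 : ℤ) : ℝ) * G m p|) (b, false, A, B)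
      simp only [Fintype.sum_prod_type, hG, if_true, Bool.false_eq_true, if_false] at e1 e2
      rw [hre, him]
      simp only [hE, Fintype.sum_prod_type, hG]
      linarith
    have h2 := norm_functional_sub_le (diagFunctional c) hL (hW a) hτ
      (fun A B => by simpa using hQ true A B) (fun A B => by simpa using hQ false A B)
    have hE0 : 0 ≤ E κ := Real.iSup_nonneg fun m => abs_nonneg _
    have h3 : ∑ i, 2 * ∑ k, ((κ i k : ℤ) : ℝ) *
        (2 / γ * (modelOutput (W a) (τ i) k - 1 / 2 ^ n)) = 4 / γ *
        (diagFunctional c fun i => outputState (W a) (τ i) - maxMixed n).re := by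
      rw [hre]
      simp only [Finset.mul_sum, Matrix.sub_apply, Complex.sub_re, maxMixed_diag_re,
        modelOutput_eq]
      exact Finset.sum_congr rfl fun i _ => Finset.sum_congr rfl fun k _ => by
        rw [hc]; ring
    rw [h3]
    calc _ ≤ 4 / γ * (g * (2 * E κ)) := by
          refine mul_le_mul_of_nonneg_left ?_ (by positivity)
          exact (Complex.re_le_norm _).trans (h2.trans
            (mul_le_mul_of_nonneg_right (hWg a) (by positivity)))
      _ = _ := by ring
  refine (expect_le_expect_univ hpt).trans ?_
  rw [← Finset.mul_expect]
  -- Twice the number of words is 2^(3+4n), and 3 + 4n ≤ 8n because n ≥ 1.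
  have hlog : Real.log (2 * Fintype.card M) ≤ 8 * n := by
    have hcard : (2 : ℝ) * Fintype.card M = 2 ^ (3 + 4 * n) := by
      simp only [hM, Fintype.card_prod, Fintype.card_bool, Fintype.card_fun, Fintype.card_fin]
      push_cast
      rw [show (4 : ℝ) = 2 ^ 2 by norm_num, ← pow_mul, pow_add, show 4 * n = 2 * n + 2 * n by ring,
        pow_add]
      ring
    rw [hcard, Real.log_pow]
    have := Real.log_two_lt_d9
    have h0 : (0 : ℝ) ≤ ((3 + 4 * n : ℕ) : ℝ) := by positivity
    have h2 : ((3 + 4 * n : ℕ) : ℝ) * Real.log 2 ≤ ((3 + 4 * n : ℕ) : ℝ) * 1 :=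
      mul_le_mul_of_nonneg_left (by linarith) h0
    refine h2.trans ?_
    push_cast
    linarith
  have hfin : √(2 * N * Real.log (2 * Fintype.card M)) ≤ 4 * √(n * N) := by
    rw [show (4 : ℝ) * √(n * N) = √(4 ^ 2 * (n * N)) by
      rw [Real.sqrt_mul (by norm_num : (0 : ℝ) ≤ 4 ^ 2), Real.sqrt_sq (by norm_num)]]
    refine Real.sqrt_le_sqrt ?_
    have := mul_le_mul_of_nonneg_left hlog (by positivity : (0 : ℝ) ≤ 2 * N)
    linarith
  calc 8 * (g / γ) * 𝔼 κ, E κ ≤ 8 * (g / γ) * (4 * √(n * N)) :=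
        mul_le_mul_of_nonneg_left (hE1.trans hfin) (by positivity)
    _ = _ := by ring

/-! ### From the ramp loss to margin losses. -/

theorem exists_ne_basis (hn : 1 ≤ n) (y : Basis n) : ∃ k, k ≠ y := by
  have : Nonempty (Fin n) := ⟨⟨0, hn⟩⟩
  exact exists_ne y

theorem expectedLoss_le_one {X : Type*} [MeasurableSpace X] (D : Measure (X × Basis n))
    [IsProbabilityMeasure D] (γ : ℝ) (g : X → Basis n → ℝ) : expectedLoss D γ g ≤ 1 :=
  measureReal_le_one

theorem empiricalLoss_nonneg {N : ℕ} {X : Type*} (S : Fin N → X × Basis n) (γ : ℝ)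
    (g : X → Basis n → ℝ) : 0 ≤ empiricalLoss S γ g := by
  unfold empiricalLoss
  positivity

theorem empiricalLoss_eq_one {N : ℕ} (hN : 1 ≤ N) {X : Type*} (S : Fin N → X × Basis n) {γ : ℝ}
    {g : X → Basis n → ℝ} (h : ∀ x y, MarginError γ (g x) y) : empiricalLoss S γ g = 1 := by
  have hN0 : (N : ℝ) ≠ 0 := by
    have : N ≠ 0 := by omega
    exact_mod_cast this
  unfold empiricalLoss
  simp [h, hN0]

theorem expectedLoss_le_integral {X : Type*} [MeasurableSpace X] (D : Measure (X × Basis n))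
    [IsProbabilityMeasure D] {γ : ℝ} (hγ : 0 < γ) {g : X → Basis n → ℝ}
    (hg : ∀ k, Measurable fun x => g x k) :
    expectedLoss D 0 g ≤ ∫ z, rampLoss γ (g z.1) z.2 ∂D := by
  have hm := measurable_rampLoss γ hg
  have hint : Integrable (fun z : X × Basis n => rampLoss γ (g z.1) z.2) D :=
    Integrable.of_bound hm.aestronglyMeasurable 1 (Filter.Eventually.of_forall fun z => by
      rw [Real.norm_of_nonneg (rampLoss_mem_Icc _ _ _).1]; exact (rampLoss_mem_Icc _ _ _).2)
  have h1 := mul_meas_ge_le_integral_of_nonneg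
    (Filter.Eventually.of_forall fun z : X × Basis n => (rampLoss_mem_Icc γ (g z.1) z.2).1) hint 1
  rw [one_mul] at h1
  exact (measureReal_mono fun z hz => one_le_rampLoss hγ hz).trans h1

theorem sum_rampLoss_le {N : ℕ} (hN : 1 ≤ N) {X : Type*} (S : Fin N → X × Basis n) {γ : ℝ}
    (hγ : 0 < γ) (g : X → Basis n → ℝ) :
    ∑ i, rampLoss γ (g (S i).1) (S i).2 ≤ N * empiricalLoss S γ g := by
  classical
  have hN0 : (N : ℝ) ≠ 0 := by
    have : N ≠ 0 := by omega
    exact_mod_cast this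
  have e : N * empiricalLoss S γ g =
      ∑ i, if MarginError γ (g (S i).1) (S i).2 then (1 : ℝ) else 0 := by
    unfold empiricalLoss
    rw [mul_div_cancel₀ _ hN0, Finset.sum_boole]
  rw [e]
  refine Finset.sum_le_sum fun i _ => ?_
  split_ifs with h
  · exact (rampLoss_mem_Icc _ _ _).2
  · exact rampLoss_le_zero hγ h

/-- Uniform deviations over all admissible models with `chainNorm W ≤ g`. -/
theorem measure_exists_deviation_le {L N : ℕ} (hn : 1 ≤ n) (hL : 1 ≤ L) (hN : 1 ≤ N)
    {X : Type*} [MeasurableSpace X] {ρ : X → Op n} (hρ : ∀ x, IsDensity (ρ x))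
    (hρm : ∀ a b, Measurable fun x => ρ x a b) (D : Measure (X × Basis n))
    [IsProbabilityMeasure D] {γ g s : ℝ} (hγ : 0 < γ) (hg : 0 ≤ g) (hs : 0 ≤ s) :
    (Measure.pi fun _ : Fin N => D) {S | ∃ W : Fin L → Weight n,
      (∀ j, IsQuantumChannel (layer (W j))) ∧ chainNorm W ≤ g ∧
      N * (empiricalLoss S γ fun x => modelOutput W (ρ x)) + 2 * (32 * (g / γ) * √(n * N)) + s <
        N * expectedLoss D 0 fun x => modelOutput W (ρ x)} ≤
      ENNReal.ofReal (Real.exp (-s ^ 2 / (8 * N))) := by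
  -- As a subspace of a finite-dimensional space the class is second countable, whatever its shape.
  set T := {W : Fin L → Weight n // (∀ j, IsQuantumChannel (layer (W j))) ∧ chainNorm W ≤ g}
  have : SecondCountableTopology (Fin L → Weight n) :=
    inferInstanceAs (SecondCountableTopology (Fin L → PauliIdx n → PauliIdx n → ℂ))
  have : SecondCountableTopology T := TopologicalSpace.Subtype.secondCountableTopology _
  set h : T → X × Basis n → ℝ := fun W z => rampLoss γ (modelOutput W.1 (ρ z.1)) z.2 with hh
  have hm : ∀ W, Measurable (h W) := fun W =>
    measurable_rampLoss γ (f := fun x => modelOutput W.1 (ρ x))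
      fun k => measurable_modelOutput hρm W.1 k
  have hc : ∀ z, Continuous fun W => h W z := fun z =>
    continuous_rampLoss γ z.2 (f := fun W : T => modelOutput W.1 (ρ z.1)) fun k =>
      (continuous_modelOutput (ρ z.1) k).comp continuous_subtype_val
  refine (measure_mono ?_).trans (UniformDeviation.measure_exists_gt_le D hN hm
    (fun W z => rampLoss_mem_Icc _ _ _) hc (B := 32 * (g / γ) * √(n * N))
    (fun m w z => expect_iSup_rampLoss_le hn hL hN hγ hg (fun a => (w a).1) (fun a => (w a).2.1)
      (fun a => (w a).2.2) (fun i => hρ (z i).1) fun i => (z i).2) hs)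
  rintro S ⟨W, hW, hWg, hlt⟩
  refine ⟨⟨W, hW, hWg⟩, ?_⟩
  have h1 := expectedLoss_le_integral D hγ (g := fun x => modelOutput W (ρ x))
    fun k => measurable_modelOutput hρm W k
  have h2 := sum_rampLoss_le hN S hγ fun x => modelOutput W (ρ x)
  have h3 := mul_le_mul_of_nonneg_left h1 (Nat.cast_nonneg (α := ℝ) N)
  simp only [Finset.sum_sub_distrib, Finset.sum_const, Finset.card_univ, Fintype.card_fin,
    nsmul_eq_mul]
  linarith

/-! ### Comparison with `complexity`. -/

theorem sparsity_le_maxSparsity {L : ℕ} (W : Fin L → Weight n) (j : Fin L) :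
    sparsity (W j) ≤ maxSparsity W :=
  Finset.le_sup (f := fun j => sparsity (W j)) (Finset.mem_univ j)

theorem frobSq_nonneg (W : Weight n) : 0 ≤ frobSq W :=
  Finset.sum_nonneg fun _ _ => Finset.sum_nonneg fun _ _ => sq_nonneg _

theorem chainNorm_sq_le {L : ℕ} (W : Fin L → Weight n) :
    chainNorm W ^ 2 ≤ betaPM W ^ 2 * maxSparsity W * totalFrobSq W := by
  have hF : ∀ j, frobSq (W j) ≤ totalFrobSq W := fun j =>
    Finset.single_le_sum (f := fun j => frobSq (W j)) (fun j _ => frobSq_nonneg _)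
      (Finset.mem_univ j)
  have hF0 : 0 ≤ totalFrobSq W := Finset.sum_nonneg fun j _ => frobSq_nonneg _
  have h1 : chainNorm W ≤ √(maxSparsity W * totalFrobSq W) * betaPM W := by
    refine chainNorm_le_mul_betaPM W fun j => Real.le_sqrt_of_sq_le ?_
    refine (normOneOne_sq_le _).trans (mul_le_mul ?_ (hF j) (frobSq_nonneg _) (by positivity))
    exact_mod_cast sparsity_le_maxSparsity W j
  have h2 := pow_le_pow_left₀ (chainNorm_nonneg W) h1 2
  rw [mul_pow, Real.sq_sqrt (by positivity)] at h2
  linarith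

theorem maxSparsity_mul_log_two_le {L : ℕ} (hL : 1 ≤ L) (W : Fin L → Weight n) :
    maxSparsity W * Real.log 2 ≤ Real.log (∑ j, (2 : ℝ) ^ sparsity (W j)) := by
  have : Nonempty (Fin L) := ⟨⟨0, hL⟩⟩
  obtain ⟨j, _, hj⟩ := Finset.exists_mem_eq_sup (Finset.univ : Finset (Fin L))
    Finset.univ_nonempty fun j => sparsity (W j)
  rw [maxSparsity, hj, ← Real.log_pow]
  refine Real.log_le_log (by positivity) ?_
  exact Finset.single_le_sum (f := fun j => (2 : ℝ) ^ sparsity (W j)) (fun _ _ => by positivity)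
    (Finset.mem_univ j)

theorem two_mul_mul_pred_le (k : ℕ) : 2 * ((k + 1) * k) ≤ 4 ^ (k + 1) := by
  have h := (Nat.lt_two_pow_self (n := k)).le
  have h2 : k * k ≤ 4 ^ k := (Nat.mul_le_mul h h).trans (by rw [← mul_pow]; norm_num)
  have h3 : k ≤ 4 ^ k := Nat.lt_pow_self (by norm_num) |>.le
  rw [pow_succ]
  nlinarith

theorem pow_five_le (k : ℕ) : k ^ 5 ≤ 16 ^ k := by
  induction k with
  | zero => simp
  | succ k ih =>
    rcases Nat.lt_or_ge k 2 with h | h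
    · interval_cases k <;> norm_num
    · have h1 : 2 * (k + 1) ≤ 3 * k := by omega
      have h2 := Nat.pow_le_pow_left h1 5
      rw [mul_pow, mul_pow] at h2
      rw [pow_succ 16]
      omega

/-- Trivial if ξ ≥ n. Otherwise each `normOneOne (W j)` is at most ξ(ξ+1)/4^n ≤ n²/4^n, so
`chainNorm W ≤ 2n²/4^n`, and n⁵ ≤ 16^n bounds the left side by 4. -/
theorem mul_chainNorm_sq_le {L : ℕ} (hn : 1 ≤ n) {W : Fin L → Weight n}
    (h : ∀ j, IsQuantumChannel (layer (W j))) :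
    n * chainNorm W ^ 2 ≤ maxSparsity W * chainNorm W ^ 2 + 4 := by
  rcases le_or_gt n (maxSparsity W) with hx | hx
  · have : (n : ℝ) ≤ maxSparsity W := by exact_mod_cast hx
    have := mul_le_mul_of_nonneg_right this (sq_nonneg (chainNorm W))
    linarith
  obtain ⟨k, rfl⟩ : ∃ k, n = k + 1 := ⟨n - 1, by omega⟩
  set m : ℝ := ((k + 1 : ℕ) * k : ℝ) / 4 ^ (k + 1) with hm
  have h4 : (0 : ℝ) < 4 ^ (k + 1) := by positivity
  have hk0 : (0 : ℝ) ≤ k := Nat.cast_nonneg k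
  have hm0 : 0 ≤ m := by positivity
  have hj : ∀ j, normOneOne (W j) ≤ m := fun j => by
    refine (normOneOne_le_sparsity_mul (norm_weight_le (h j))).trans ?_
    have hs : (sparsity (W j) : ℝ) ≤ k := by
      exact_mod_cast (sparsity_le_maxSparsity W j).trans (Nat.lt_succ_iff.1 hx)
    rw [hm, mul_div_assoc']
    refine div_le_div_of_nonneg_right ?_ h4.le
    push_cast
    rw [mul_comm]
    exact mul_le_mul (by linarith) hs (by positivity) (by positivity)
  have hm2 : m ≤ 1 / 2 := by
    have := two_mul_mul_pred_le k
    have h2 : (2 : ℝ) * (((k + 1 : ℕ) : ℝ) * k) ≤ 4 ^ (k + 1) := by exact_mod_cast this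
    rw [hm, div_le_iff₀ h4]
    linarith
  have hc := chainNorm_le_two_mul W hm0 hm2 hj
  have hmn : m ≤ ((k + 1 : ℕ) : ℝ) ^ 2 / 4 ^ (k + 1) := by
    refine div_le_div_of_nonneg_right ?_ h4.le
    push_cast
    nlinarith
  have h5 : ((k + 1 : ℕ) : ℝ) ^ 5 ≤ 16 ^ (k + 1) := by exact_mod_cast pow_five_le (k + 1)
  have hc2 : chainNorm W ^ 2 ≤ 4 * (((k + 1 : ℕ) : ℝ) ^ 4 / 16 ^ (k + 1)) := by
    have := pow_le_pow_left₀ (chainNorm_nonneg W) (hc.trans (mul_le_mul_of_nonneg_left hmn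
      zero_le_two)) 2
    refine this.trans (le_of_eq ?_)
    have e : ((4 : ℝ) ^ (k + 1)) ^ 2 = 16 ^ (k + 1) := by
      rw [← pow_mul, mul_comm, pow_mul]
      norm_num
    rw [mul_pow, div_pow, e]
    ring
  have h6 : ((k + 1 : ℕ) : ℝ) * chainNorm W ^ 2 ≤ 4 := by
    calc _ ≤ ((k + 1 : ℕ) : ℝ) * (4 * (((k + 1 : ℕ) : ℝ) ^ 4 / 16 ^ (k + 1))) :=
          mul_le_mul_of_nonneg_left hc2 (Nat.cast_nonneg _)
      _ = 4 * (((k + 1 : ℕ) : ℝ) ^ 5 / 16 ^ (k + 1)) := by ring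
      _ ≤ 4 * 1 := mul_le_mul_of_nonneg_left ((div_le_one (by positivity)).2 h5) (by norm_num)
      _ = 4 := by norm_num
  have : (0 : ℝ) ≤ maxSparsity W * chainNorm W ^ 2 := by positivity
  linarith

theorem one_le_growthM {L ξ : ℕ} (hL : 1 ≤ L) (hξ : 1 ≤ ξ) : 1 ≤ growthM n L ξ := by
  unfold growthM
  have hξ1 : (1 : ℝ) ≤ ξ := by exact_mod_cast hξ
  split_ifs with h
  · exact_mod_cast hL
  · have hc : 0 ≤ growthRatio n ξ := by
      unfold growthRatio
      exact div_nonneg (by nlinarith) (by positivity)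
    rw [← geom_sum_eq h]
    calc (1 : ℝ) = growthRatio n ξ ^ 0 := (pow_zero _).symm
      _ ≤ _ := Finset.single_le_sum (f := fun i => growthRatio n ξ ^ i)
        (fun i _ => pow_nonneg hc i) (Finset.mem_range.2 hL)

/-- The cap enters only through this lower bound. Sparsity zero must be excluded: the growth ratio
is then negative and `growthM` can fall below 1. -/
theorem one_le_betaCap {L : ℕ} (hL : 1 ≤ L) (N : ℕ) (γ : ℝ) {W : Fin L → Weight n}
    (hξ : 1 ≤ maxSparsity W) : 1 ≤ betaCap N γ W := by
  unfold betaCap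
  split_ifs
  · exact one_le_growthM hL hξ
  · exact le_min (le_max_left _ _) (one_le_growthM hL hξ)

/-- The numerator under the square root in `complexity`. -/
noncomputable def complexityNum {L : ℕ} (N : ℕ) (γ δ : ℝ) (W : Fin L → Weight n) : ℝ :=
  betaPM W ^ 2 * (maxSparsity W : ℝ) * Real.log (∑ j, (2 : ℝ) ^ sparsity (W j)) * totalFrobSq W
      + Real.log ((N : ℝ) * L * betaCap N γ W / δ)

theorem le_complexityNum {L N : ℕ} (hL : 1 ≤ L) (hN : 1 ≤ N) (γ : ℝ) {δ : ℝ} (hδ : 0 < δ)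
    {W : Fin L → Weight n} (hξ : 1 ≤ maxSparsity W) :
    Real.log 2 * (maxSparsity W * chainNorm W ^ 2) + Real.log (1 / δ) + Real.log N ≤
      complexityNum N γ δ W := by
  have hN1 : (1 : ℝ) ≤ N := by exact_mod_cast hN
  have hL1 : (1 : ℝ) ≤ L := by exact_mod_cast hL
  have hcap := one_le_betaCap hL N γ hξ
  have hF0 : 0 ≤ totalFrobSq W := Finset.sum_nonneg fun j _ => frobSq_nonneg _
  have h1 := mul_le_mul_of_nonneg_left (maxSparsity_mul_log_two_le hL W)
    (by positivity : 0 ≤ betaPM W ^ 2 * (maxSparsity W : ℝ) * totalFrobSq W)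
  have h2 := mul_le_mul_of_nonneg_left (chainNorm_sq_le W)
    (by positivity : 0 ≤ Real.log 2 * maxSparsity W)
  have h3 : Real.log (1 / δ) + Real.log N ≤ Real.log ((N : ℝ) * L * betaCap N γ W / δ) := by
    rw [← Real.log_mul (by positivity) (by positivity)]
    refine Real.log_le_log (by positivity) ?_
    rw [one_div_mul_eq_div]
    refine div_le_div_of_nonneg_right ?_ hδ.le
    rw [mul_assoc]
    refine le_mul_of_one_le_right (by positivity) ?_
    nlinarith
  unfold complexityNum
  nlinarith

/-- The least such r works; the hypothesis serves the case r = 0, where 1 ≤ 2x is required. -/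
theorem exists_dyadic {x : ℝ} (hx : 1 / 2 < x) : ∃ r : ℕ, x ≤ 2 ^ r ∧ (2 : ℝ) ^ r ≤ 2 * x := by
  classical
  have hex : ∃ r : ℕ, x ≤ 2 ^ r := by
    obtain ⟨r, hr⟩ := pow_unbounded_of_one_lt x one_lt_two
    exact ⟨r, hr.le⟩
  refine ⟨Nat.find hex, Nat.find_spec hex, ?_⟩
  rcases h : Nat.find hex with _ | k
  · rw [pow_zero]; linarith
  · have := Nat.find_min hex (m := k) (by omega)
    rw [pow_succ]
    linarith [not_le.1 this]

/-- All scores lie within `chainNorm W` of 1/2^n, so no margin exceeds γ. -/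
theorem marginError_of_chainNorm_le {L : ℕ} (hn : 1 ≤ n) (hL : 1 ≤ L) {W : Fin L → Weight n}
    (h : ∀ j, IsQuantumChannel (layer (W j))) {τ : Op n} (hτ : IsDensity τ) {γ : ℝ}
    (hγ : 2 * chainNorm W ≤ γ) (y : Basis n) : MarginError γ (modelOutput W τ) y := by
  obtain ⟨k, hk⟩ := exists_ne_basis hn y
  have h1 := (abs_le.1 (abs_modelOutput_sub_le hL h hτ y)).2
  have h2 := (abs_le.1 (abs_modelOutput_sub_le hL h hτ k)).1
  exact ⟨k, hk, by linarith⟩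

theorem marginError_of_one_le {L : ℕ} (hn : 1 ≤ n) {W : Fin L → Weight n}
    (h : ∀ j, IsQuantumChannel (layer (W j))) {τ : Op n} (hτ : IsDensity τ) {γ : ℝ}
    (hγ : 1 ≤ γ) (y : Basis n) : MarginError γ (modelOutput W τ) y := by
  obtain ⟨k, hk⟩ := exists_ne_basis hn y
  have h1 := (isDensity_diag_mem_Icc (outputState_isDensity h hτ) y).2
  have h2 := (isDensity_diag_mem_Icc (outputState_isDensity h hτ) k).1
  exact ⟨k, hk, by rw [modelOutput_eq, modelOutput_eq]; linarith⟩

theorem one_le_maxSparsity_of_chainNorm_pos {L : ℕ} {W : Fin L → Weight n}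
    (h : 0 < chainNorm W) : 1 ≤ maxSparsity W := by
  by_contra h0
  have h1 := chainNorm_sq_le W
  rw [Nat.lt_one_iff.1 (not_le.1 h0)] at h1
  have h2 : 0 < chainNorm W ^ 2 := by positivity
  simp at h1
  linarith

theorem mul_sqrt_div_eq {N γ Y c : ℝ} (hN : 0 < N) (hγ : 0 < γ) (hc : 0 ≤ c) :
    N * (c * √(Y / (γ ^ 2 * N))) = √(c ^ 2 * N * Y / γ ^ 2) := by
  rw [← mul_assoc, show c ^ 2 * N * Y / γ ^ 2 = (N * c) ^ 2 * (Y / (γ ^ 2 * N)) by field_simp,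
    Real.sqrt_mul (sq_nonneg _), Real.sqrt_sq (by positivity)]

/-- The bound at a single dyadic scale is of the order of `complexity`. -/
theorem deviation_le_complexity {L N r : ℕ} (hn : 1 ≤ n) (hL : 1 ≤ L) (hN : 2 ≤ N) {γ δ : ℝ}
    (hγ : 0 < γ) (hγ1 : γ < 1) (hδ : 0 < δ) (hδ1 : δ < 1) {W : Fin L → Weight n}
    (h : ∀ j, IsQuantumChannel (layer (W j))) (hc : γ < 2 * chainNorm W)
    (hr : (2 : ℝ) ^ r ≤ 2 * (chainNorm W / γ)) :
    2 * (32 * (γ * 2 ^ r / γ) * √(n * N)) + √(8 * N * (Real.log (1 / δ) + (r + 1) * Real.log 2))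
      ≤ N * (500 * complexity N γ δ W) := by
  set G := chainNorm W with hG
  set Y := complexityNum N γ δ W with hY
  have hcomp : complexity N γ δ W = √(Y / (γ ^ 2 * N)) := rfl
  have hN0 : (0 : ℝ) < N := by
    have : 0 < N := by omega
    exact_mod_cast this
  have hn1 : (1 : ℝ) ≤ n := by exact_mod_cast hn
  have hG0 : 0 < G := by linarith
  have hξ := one_le_maxSparsity_of_chainNorm_pos hG0
  have hYl := le_complexityNum hL (by omega : 1 ≤ N) γ hδ hξ
  rw [← hY, ← hG] at hYl
  have hl2 : 1 / 2 < Real.log 2 := by linarith [Real.log_two_gt_d9]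
  have hl2' : Real.log 2 ≤ 1 := by linarith [Real.log_two_lt_d9]
  have hlN : Real.log 2 ≤ Real.log N := Real.log_le_log (by norm_num) (by exact_mod_cast hN)
  have hlδ : 0 ≤ Real.log (1 / δ) := Real.log_nonneg ((one_le_div hδ).2 hδ1.le)
  have hξG : 0 ≤ (maxSparsity W : ℝ) * G ^ 2 := by positivity
  -- The additive 4 from `mul_chainNorm_sq_le` is absorbed by 8 log N ≥ 8 log 2 ≥ 4, which is where
  -- N ≥ 2 matters.
  have hnG : n * G ^ 2 ≤ 8 * Y := by
    have h1 := mul_chainNorm_sq_le hn h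
    rw [← hG] at h1
    nlinarith
  have hlY : Real.log (1 / δ) ≤ Y := by nlinarith
  have hY0 : 0 ≤ Y := hlδ.trans hlY
  have hx2 : (2 : ℝ) ^ r * √(n * N) ≤ N * (6 * √(Y / (γ ^ 2 * N))) := by
    rw [mul_sqrt_div_eq hN0 hγ (by norm_num)]
    refine Real.le_sqrt_of_sq_le ?_
    rw [mul_pow, Real.sq_sqrt (by positivity)]
    calc ((2 : ℝ) ^ r) ^ 2 * (n * N) ≤ (2 * (G / γ)) ^ 2 * (n * N) :=
          mul_le_mul_of_nonneg_right (pow_le_pow_left₀ (by positivity) hr 2) (by positivity)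
      _ = (4 * N / γ ^ 2) * (n * G ^ 2) := by field_simp; ring
      _ ≤ (4 * N / γ ^ 2) * (8 * Y) := mul_le_mul_of_nonneg_left hnG (by positivity)
      _ ≤ (4 * N / γ ^ 2) * (9 * Y) := mul_le_mul_of_nonneg_left (by linarith) (by positivity)
      _ = _ := by ring
  have hs : √(8 * N * (Real.log (1 / δ) + (r + 1) * Real.log 2)) ≤
      N * (17 * √(Y / (γ ^ 2 * N))) := by
    rw [mul_sqrt_div_eq hN0 hγ (by norm_num)]
    refine Real.sqrt_le_sqrt ?_
    have hγ2 : γ ^ 2 ≤ 1 := pow_le_one₀ hγ.le hγ1.le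
    have h1 : Y ≤ Y / γ ^ 2 := le_div_self hY0 (by positivity) hγ2
    -- The price of the union bound over scales needs no extra logarithm: r + 1 ≤ 2^r ≤ 2G/γ ≤
    -- (2G/γ)², since 2G/γ ≥ 1.
    have h2 : ((r : ℝ) + 1) * Real.log 2 ≤ 32 * (Y / γ ^ 2) := by
      have hr1 : (r : ℝ) + 1 ≤ 2 ^ r := by exact_mod_cast Nat.lt_two_pow_self (n := r)
      have hx : 1 ≤ 2 * (G / γ) := by
        rw [← mul_div_assoc, one_le_div hγ]
        exact hc.le
      have hsq : 2 * (G / γ) ≤ (2 * (G / γ)) ^ 2 := by nlinarith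
      have hG2 : (2 * (G / γ)) ^ 2 ≤ 32 * (Y / γ ^ 2) := by
        have : G ^ 2 ≤ 8 * Y := (le_mul_of_one_le_left (sq_nonneg G) hn1).trans hnG
        have := div_le_div_of_nonneg_right this (sq_nonneg γ)
        calc _ = 4 * (G ^ 2 / γ ^ 2) := by field_simp; ring
          _ ≤ 4 * (8 * Y / γ ^ 2) := by linarith
          _ = _ := by ring
      calc ((r : ℝ) + 1) * Real.log 2 ≤ ((r : ℝ) + 1) * 1 :=
            mul_le_mul_of_nonneg_left hl2' (by positivity)
        _ ≤ _ := by linarith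
    calc 8 * N * (Real.log (1 / δ) + (r + 1) * Real.log 2) ≤ 8 * N * (33 * (Y / γ ^ 2)) :=
          mul_le_mul_of_nonneg_left (by linarith) (by positivity)
      _ = 264 * N * Y / γ ^ 2 := by ring
      _ ≤ 17 ^ 2 * N * Y / γ ^ 2 := by
        refine div_le_div_of_nonneg_right ?_ (sq_nonneg γ)
        have : 0 ≤ N * Y := by positivity
        linarith
  rw [mul_div_cancel_left₀ _ hγ.ne', hcomp]
  -- The total constant is 2·32·6 + 17 = 401 ≤ 500.
  have : 0 ≤ N * √(Y / (γ ^ 2 * N)) := by positivity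
  linarith

/-- For a single example the bound is trivial as soon as the margin `γ` is attainable. -/
theorem one_le_complexity_of_single {L : ℕ} (hL : 1 ≤ L) {γ δ : ℝ} (hγ : 0 < γ) (hδ : 0 < δ)
    (hδ1 : δ < 1) {W : Fin L → Weight n} (hc : γ < 2 * chainNorm W) :
    1 ≤ 500 * complexity 1 γ δ W := by
  have hG0 : 0 < chainNorm W := by linarith
  have hξ := one_le_maxSparsity_of_chainNorm_pos hG0
  have hYl := le_complexityNum hL le_rfl γ hδ hξ
  have hξ1 : (1 : ℝ) ≤ maxSparsity W := by exact_mod_cast hξ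
  have hl2 : 1 / 2 < Real.log 2 := by linarith [Real.log_two_gt_d9]
  have hlδ : 0 ≤ Real.log (1 / δ) := Real.log_nonneg ((one_le_div hδ).2 hδ1.le)
  have hcomp : complexity 1 γ δ W = √(complexityNum 1 γ δ W / (γ ^ 2 * (1 : ℕ))) := rfl
  have h1 : chainNorm W ^ 2 ≤ maxSparsity W * chainNorm W ^ 2 :=
    le_mul_of_one_le_left (sq_nonneg _) hξ1
  have h2 : γ ^ 2 ≤ (2 * chainNorm W) ^ 2 := pow_le_pow_left₀ hγ.le hc.le 2
  have h3 : 1 / 500 ≤ complexity 1 γ δ W := by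
    rw [hcomp]
    refine Real.le_sqrt_of_sq_le ?_
    rw [Nat.cast_one, mul_one, le_div_iff₀ (by positivity)]
    simp only [Nat.cast_one, Real.log_one] at hYl
    nlinarith
  linarith

end PMModel

/-- The bad event is measured by the outer measure of the `N`-fold product of `D`, so no
measurability of the event (an uncountable union over parameters) is presupposed. -/
theorem mainTheorem1 :
    ∃ C : ℝ, 0 < C ∧
      ∀ (n L N : ℕ), 1 ≤ n → 1 ≤ L → 1 ≤ N →
      ∀ (X : Type*) [MeasurableSpace X]
        (ρ : X → PMModel.Op n), (∀ x, PMModel.IsDensity (ρ x)) →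
        (∀ a b, Measurable fun x => ρ x a b) →
      ∀ (D : Measure (X × PMModel.Basis n)) [IsProbabilityMeasure D],
      ∀ γ δ : ℝ, 0 < γ → 0 < δ →
        (Measure.pi fun _ : Fin N => D)
          {S | ¬ ∀ W : Fin L → PMModel.Weight n,
            (∀ j, PMModel.IsQuantumChannel (PMModel.layer (W j))) →
              PMModel.expectedLoss D 0 (fun x => PMModel.modelOutput W (ρ x))
                ≤ PMModel.empiricalLoss S γ (fun x => PMModel.modelOutput W (ρ x))
                  + C * PMModel.complexity N γ δ W}
          ≤ ENNReal.ofReal δ := by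
  refine ⟨500, by norm_num, ?_⟩
  intro n L N hn hL hN X _ ρ hρ hρm D _ γ δ hγ hδ
  rcases le_or_gt 1 δ with hδ1 | hδ1
  · refine prob_le_one.trans ?_
    rw [← ENNReal.ofReal_one]
    exact ENNReal.ofReal_le_ofReal hδ1
  have hN0 : (0 : ℝ) < N := by exact_mod_cast hN
  have hlδ : 0 ≤ Real.log (1 / δ) := Real.log_nonneg ((one_le_div hδ).2 hδ1.le)
  have hl2 : 0 ≤ Real.log 2 := Real.log_nonneg one_le_two
  -- Chosen so that exp(-s²/(8N)) = δ/2^(r+1); these sum to δ.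
  set s : ℕ → ℝ := fun r => √(8 * N * (Real.log (1 / δ) + (r + 1) * Real.log 2)) with hs
  set bad : ℕ → Set (Fin N → X × PMModel.Basis n) := fun r =>
    {S | ∃ W : Fin L → PMModel.Weight n,
      (∀ j, PMModel.IsQuantumChannel (PMModel.layer (W j))) ∧ PMModel.chainNorm W ≤ γ * 2 ^ r ∧
      N * (PMModel.empiricalLoss S γ fun x => PMModel.modelOutput W (ρ x))
        + 2 * (32 * (γ * 2 ^ r / γ) * √(n * N)) + s r <
        N * PMModel.expectedLoss D 0 fun x => PMModel.modelOutput W (ρ x)} with hbad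
  have hbound : ∀ r, (Measure.pi fun _ : Fin N => D) (bad r) ≤
      ENNReal.ofReal (δ / 2 / 2 ^ r) := fun r => by
    refine (PMModel.measure_exists_deviation_le hn hL hN hρ hρm D hγ (by positivity)
      (Real.sqrt_nonneg _)).trans (le_of_eq ?_)
    congr 1
    have h0 : 0 ≤ 8 * N * (Real.log (1 / δ) + (r + 1) * Real.log 2) := by positivity
    rw [Real.sq_sqrt h0, show -(8 * N * (Real.log (1 / δ) + (r + 1) * Real.log 2)) / (8 * N) =
      Real.log δ + ((r + 1 : ℕ) : ℝ) * -Real.log 2 by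
        rw [one_div, Real.log_inv]; push_cast; field_simp; ring,
      Real.exp_add, Real.exp_log hδ, Real.exp_nat_mul, Real.exp_neg, Real.exp_log two_pos, pow_succ,
      inv_pow]
    field_simp
  refine (measure_mono (t := ⋃ r, bad r) ?_).trans ?_
  · intro S hS
    by_contra hnb
    refine hS fun W hW => ?_
    have hcomp0 : 0 ≤ PMModel.complexity N γ δ W := Real.sqrt_nonneg _
    have hle1 := PMModel.expectedLoss_le_one D 0 fun x => PMModel.modelOutput W (ρ x)
    rcases le_or_gt (2 * PMModel.chainNorm W) γ with hc | hc
    · rw [PMModel.empiricalLoss_eq_one hN S fun x y =>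
        PMModel.marginError_of_chainNorm_le hn hL hW (hρ x) hc y]
      linarith
    rcases le_or_gt 1 γ with hγ1 | hγ1
    · rw [PMModel.empiricalLoss_eq_one hN S fun x y =>
        PMModel.marginError_of_one_le hn hW (hρ x) hγ1 y]
      linarith
    rcases hN.eq_or_lt with rfl | hN2
    · have := PMModel.one_le_complexity_of_single hL hγ hδ hδ1 hc
      have := PMModel.empiricalLoss_nonneg S γ fun x => PMModel.modelOutput W (ρ x)
      linarith
    -- The scale of this model: γ2^r lies between `chainNorm W` and twice it.
    obtain ⟨r, hr1, hr2⟩ := PMModel.exists_dyadic (x := PMModel.chainNorm W / γ)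
      (by rw [div_lt_div_iff₀ two_pos hγ]; linarith)
    have hnot : S ∉ bad r := fun h => hnb (Set.mem_iUnion.2 ⟨r, h⟩)
    have hdev : N * PMModel.expectedLoss D 0 (fun x => PMModel.modelOutput W (ρ x)) ≤
        N * (PMModel.empiricalLoss S γ fun x => PMModel.modelOutput W (ρ x))
        + 2 * (32 * (γ * 2 ^ r / γ) * √(n * N)) + s r :=
      not_lt.1 fun h => hnot ⟨W, hW, by rw [div_le_iff₀ hγ] at hr1; linarith, h⟩
    have hfin := PMModel.deviation_le_complexity hn hL hN2 hγ hγ1 hδ hδ1 hW hc hr2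
    refine le_of_mul_le_mul_left ?_ hN0
    rw [mul_add]
    linarith
  · refine (measure_iUnion_le _).trans ((ENNReal.tsum_le_tsum hbound).trans (le_of_eq ?_))
    rw [← ENNReal.ofReal_tsum_of_nonneg (fun r => by positivity) (summable_geometric_two' δ),
      tsum_geometric_two']
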